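/- Let $\tilde W_\infty=\bigcup_n \tilde W_n$ be the Weyl group of type $D_\infty$: all signed permutations $w=(w_1,w_2,\ldots)$ of the positive integers which fix all but finitely many integers and have an even number of sign changes. It acts on nonzero integers by $w(-i)=-w(i)$, it contains the group $S_\infty$ of finite permutations, and it is generated by the simple reflections $s_i=(i,i+1)$ for $i\ge 1$ and $s_\Box$, where $(w_1,w_2,w_3,\ldots)s_\Box=(-w_2,-w_1,w_3,\ldots)$. Let $\ell$ be the length function for these generators; they are indexed by $\mathbb N_\Box=\{\Box,1,2,\ldots\}$, ordered by $\Box<1<2<\cdots$, and $\Box$ is read as $0$ in inequalities and in indices. An element $w$ has a descent at $r\in\mathbb N_\Box$ if $\ell(ws_r)<\ell(w)$. A reduced factorization $u_1\cdots u_m=w$ is one with $\ell(u_1)+\cdots+\ell(u_m)=\ell(w)$. For $n\ge2$, let $u_w$ ($w\in\tilde W_n$) be the standard basis of the nilCoxeter algebra of $\tilde W_n$, with $u_vu_w=u_{vw}$ if $\ell(vw)=\ell(v)+\ell(w)$ and $u_vu_w=0$ otherwise; put $u_i=u_{s_i}$ and let $\langle\xi,w\rangle$ be the coefficient of $u_w$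 in $\xi$. For $i\ge 1$ set $$A_i(t)=(1+tu_{n-1})\cdots(1+tu_i),\qquad \tilde A_i(t)=(1-tu_i)\cdots(1-tu_{n-1}),$$ $$D(t)=(1+tu_{n-1})\cdots(1+tu_2)(1+tu_1)(1+tu_\Box)(1+tu_2)\cdots(1+tu_{n-1}).$$ For sequences of variables set $A(Y)=\prod_i A_1(y_i)$, $\tilde A(Z)=\prod_j\tilde A_1(z_j)$ and $D(X)=D(x_1)D(x_2)\cdots$. For $w\in\tilde W_n$ the type D double Schubert polynomial is $$\mathfrak D_w(X;Y,Z)=\langle\tilde A_{n-1}(z_{n-1})\cdots\tilde A_1(z_1)\,D(X)\,A_1(y_1)\cdots A_{n-1}(y_{n-1}),\,w\rangle,$$ the type D double mixed Stanley function is $I_w(X;Y/Z)=\langle\tilde A(Z)D(X)A(Y),w\rangle$, and for $u\in S_n$ the type A double Stanley function is $G_u(Y/Z)=\langle\tilde A(Z)A(Y),u\rangle$, with $G_u(Y)=G_u(Y/0)$. These do not depend on the choice of $n$. Let $p,q\ge1$, let $\mathfrak a: a_1<\cdots<a_p$ and $\mathfrak b: b_1<\cdots<b_q$ be sequences in $\mathbb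 N_\Box$, and let $w\in\tilde W_\infty$ be such that $w$ is compatible with $\mathfrak a$ and $w^{-1}$ is compatible with $\mathfrak b$, i.e. all descent positions of $w$ lie in $\{a_1,\ldots,a_p\}$ and all descent positions of $w^{-1}$ lie in $\{b_1,\ldots,b_q\}$. With $a_0=b_0=0$, put $Y_i=\{y_{a_{i-1}+1},\ldots,y_{a_i}\}$ and $Z_j=\{z_{b_{j-1}+1},\ldots,z_{b_j}\}$. Call a reduced factorization $u_1\cdots u_{p+q-1}=w$ in $\tilde W_\infty$ compatible with $\mathfrak a,\mathfrak b$ if $u_j\in S_\infty$ for all $j\ne q$, $u_j(i)=i$ whenever $j<q$ and $1\le i\le b_{q-j}$, and $u_j(i)=i$ whenever $j>q$ and $1\le i\le a_{j-q}$. Then there are only finitely many reduced factorizations of $w$ compatible with $\mathfrak a,\mathfrak b$, and $$\mathfrak D_w(X;Y,Z)=\sum G_{u_1}(0/Z_q)\cdots G_{u_{q-1}}(0/Z_2)\;I_{u_q}(X;Y_1/Z_1)\;G_{u_{q+1}}(Y_2)\cdots G_{u_{p+q-1}}(Y_p),$$ summed over all reduced factorizations $u_1\cdots u_{p+q-1}=w$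 compatible with $\mathfrak a,\mathfrak b$. -/

import Mathlib

noncomputable section

namespace TypeDSchubert

/-! ### The Weyl group of type `D_∞` -/

/-- The set of positive integers which a permutation of `ℤ` sends to negative integers. -/
def negSet (σ : Equiv.Perm ℤ) : Set ℤ := {i | 0 < i ∧ σ i < 0}

/-- Signed permutations: permutations `σ` of `ℤ` with `σ (-i) = -σ i` which fix all but finitely
many integers, such that the number of sign changes is even. -/
def IsEvenSigned (σ : Equiv.Perm ℤ) : Prop :=
  (∀ i, σ (-i) = -σ i) ∧ (∃ n : ℕ, ∀ i : ℤ, (n : ℤ) < i → σ i = i) ∧ Even (negSet σ).ncard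

theorem finite_negSet {σ : Equiv.Perm ℤ} (h : ∃ n : ℕ, ∀ i : ℤ, (n : ℤ) < i → σ i = i) :
    (negSet σ).Finite := by
  obtain ⟨n, hn⟩ := h
  refine (Set.finite_Icc (0 : ℤ) n).subset ?_
  rintro i ⟨h0, h1⟩
  refine ⟨h0.le, ?_⟩
  by_contra hlt
  have := hn i (by omega)
  omega

theorem isEvenSigned_one : IsEvenSigned 1 := by
  refine ⟨fun i => rfl, ⟨0, fun i _ => rfl⟩, ?_⟩
  have : negSet 1 = ∅ := by
    ext i
    simp only [negSet, Set.mem_ofPred_eq, Equiv.Perm.one_apply, Set.mem_empty_iff_false, iff_false]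
    omega
  simp [this]

theorem apply_zero {σ : Equiv.Perm ℤ} (h : ∀ i, σ (-i) = -σ i) : σ 0 = 0 := by
  have := h 0
  simp only [neg_zero] at this
  omega

theorem apply_ne_zero {σ : Equiv.Perm ℤ} (h : ∀ i, σ (-i) = -σ i) {i : ℤ} (hi : i ≠ 0) :
    σ i ≠ 0 := fun h0 => hi (σ.injective (h0.trans (apply_zero h).symm))

theorem IsEvenSigned.mul {σ τ : Equiv.Perm ℤ} (hσ : IsEvenSigned σ) (hτ : IsEvenSigned τ) :
    IsEvenSigned (σ * τ) := by
  have hfs := finite_negSet hσ.2.1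
  have hft := finite_negSet hτ.2.1
  obtain ⟨os, ⟨n, hn⟩, es⟩ := hσ
  obtain ⟨ot, ⟨m, hm⟩, et⟩ := hτ
  refine ⟨fun i => by simp [ot, os], ⟨max n m, fun i hi => ?_⟩, ?_⟩
  · have h1 : τ i = i := hm i (by push_cast at hi; omega)
    have h2 : σ i = i := hn i (by push_cast at hi; omega)
    simp [h1, h2]
  · set B : Set ℤ := {i | 0 < i ∧ σ (abs (τ i)) < 0} with hB
    have hinj : Set.InjOn (fun i => abs (τ i)) B := by
      intro i hi j hj hij
      rcases abs_eq_abs.1 hij with h | h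
      · exact τ.injective h
      · rw [← ot] at h
        have := τ.injective h
        have h1 := hi.1
        have h2 := hj.1
        omega
    have himg : (fun i => abs (τ i)) '' B = negSet σ := by
      ext k
      constructor
      · rintro ⟨i, hi, rfl⟩
        exact ⟨abs_pos.2 (apply_ne_zero ot hi.1.ne'), hi.2⟩
      · rintro ⟨hk, hk'⟩
        have hne : τ.symm k ≠ 0 := fun h0 => by
          have := (Equiv.symm_apply_eq τ).1 h0
          rw [apply_zero ot] at this
          omega
        have key : abs (τ (abs (τ.symm k))) = k := by
          rcases abs_choice (τ.symm k) with h | h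
          · rw [h, Equiv.apply_symm_apply, abs_of_pos hk]
          · rw [h, ot, Equiv.apply_symm_apply, abs_neg, abs_of_pos hk]
        refine ⟨abs (τ.symm k), ⟨abs_pos.2 hne, ?_⟩, key⟩
        rw [key]
        exact hk'
    have hBf : B.Finite := Set.Finite.of_finite_image (himg ▸ hfs) hinj
    have hBc : Even B.ncard := by
      rw [← Set.InjOn.ncard_image hinj, himg]
      exact es
    have hsym : negSet (σ * τ) = (B \ negSet τ) ∪ (negSet τ \ B) := by
      ext i
      simp only [negSet, hB, Set.mem_union, Set.mem_sdiff, Set.mem_ofPred_eq, Equiv.Perm.mul_apply]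
      rcases lt_trichotomy (τ i) 0 with h | h | h
      · rw [abs_of_neg h, os]
        have := apply_ne_zero os h.ne
        constructor <;> omega
      · have h0 : ¬ 0 < i := fun hi => apply_ne_zero ot hi.ne' h
        tauto
      · rw [abs_of_pos h]
        constructor <;> omega
    have hd : Disjoint (B \ negSet τ) (negSet τ \ B) :=
      Set.disjoint_left.2 fun i h1 h2 => h2.2 h1.1
    rw [hsym, Set.ncard_union_eq hd hBf.sdiff hft.sdiff]
    have e1 := Set.ncard_inter_add_ncard_sdiff_eq_ncard B (negSet τ) hBf
    have e2 := Set.ncard_inter_add_ncard_sdiff_eq_ncard (negSet τ) B hft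
    rw [Set.inter_comm] at e2
    rw [Nat.even_iff] at *
    omega

theorem perm_apply_inv (σ : Equiv.Perm ℤ) (i : ℤ) : σ (σ⁻¹ i) = i := σ.apply_symm_apply i

theorem perm_inv_apply (σ : Equiv.Perm ℤ) (i : ℤ) : σ⁻¹ (σ i) = i := σ.symm_apply_apply i

theorem IsEvenSigned.inv {σ : Equiv.Perm ℤ} (hσ : IsEvenSigned σ) : IsEvenSigned σ⁻¹ := by
  obtain ⟨os, ⟨n, hn⟩, es⟩ := hσ
  have oi : ∀ i, σ⁻¹ (-i) = -σ⁻¹ i := fun i => by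
    rw [Equiv.Perm.inv_eq_iff_eq, os, (perm_apply_inv σ)]
  refine ⟨oi, ⟨n, fun i hi => ?_⟩, ?_⟩
  · rw [Equiv.Perm.inv_eq_iff_eq, hn i hi]
  · have himg : (fun i => -σ i) '' negSet σ = negSet σ⁻¹ := by
      ext k
      constructor
      · rintro ⟨i, ⟨h1, h2⟩, rfl⟩
        refine ⟨by simpa using h2, ?_⟩
        rw [oi, (perm_inv_apply σ)]
        omega
      · rintro ⟨h1, h2⟩
        refine ⟨-σ⁻¹ k, ⟨by omega, ?_⟩, ?_⟩
        · rw [os, (perm_apply_inv σ)]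
          omega
        · simp [os]
    have hinj : Function.Injective fun i => -σ i := neg_injective.comp σ.injective
    rw [← himg, Set.ncard_image_of_injective _ hinj]
    exact es

/-- The group of signed permutations of finite support with an even number of sign changes. -/
def evenSigned : Subgroup (Equiv.Perm ℤ) where
  carrier := {σ | IsEvenSigned σ}
  mul_mem' := IsEvenSigned.mul
  one_mem' := isEvenSigned_one
  inv_mem' := IsEvenSigned.inv

/-- The Weyl group `W̃_∞`. The value of `w` at an integer `i` is `w.1 i`; for `i > 0` this is
the entry `w_i` of the signed permutation. -/
abbrev WeylD : Type := evenSigned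

/-- The simple reflections as permutations of `ℤ`. The symbol `□` is encoded by `0`, so the index
set `{□, 1, 2, …}` (ordered by `□ < 1 < 2 < ⋯`) becomes `ℕ`. The element `s_□` maps `1` to `-2` and
`2` to `-1`, and `s_i` interchanges `i` and `i + 1` for `i ≥ 1`. -/
def simplePerm : ℕ → Equiv.Perm ℤ
  | 0 => Equiv.swap 1 (-2) * Equiv.swap (-1) 2
  | (i + 1) => Equiv.swap ((i : ℤ) + 1) (i + 2) * Equiv.swap (-((i : ℤ) + 1)) (-((i : ℤ) + 2))

theorem simplePerm_zero_apply (k : ℤ) : simplePerm 0 k =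
    if k = 1 then -2 else if k = 2 then -1 else if k = -1 then 2 else if k = -2 then 1 else k := by
  simp only [simplePerm, Equiv.Perm.mul_apply, Equiv.swap_apply_def]
  grind

theorem simplePerm_succ_apply (i : ℕ) (k : ℤ) : simplePerm (i + 1) k =
    if k = i + 1 then (i : ℤ) + 2 else if k = i + 2 then (i : ℤ) + 1
    else if k = -(i + 1) then -((i : ℤ) + 2) else if k = -(i + 2) then -((i : ℤ) + 1) else k := by
  simp only [simplePerm, Equiv.Perm.mul_apply, Equiv.swap_apply_def]
  grind

theorem isEvenSigned_simplePerm (i : ℕ) : IsEvenSigned (simplePerm i) := by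
  cases i with
  | zero =>
    refine ⟨fun k => ?_, ⟨2, fun k hk => ?_⟩, ?_⟩
    · simp only [simplePerm_zero_apply]
      split_ifs <;> omega
    · rw [simplePerm_zero_apply]
      push_cast at hk
      split_ifs <;> omega
    · have : negSet (simplePerm 0) = {1, 2} := by
        ext k
        simp only [negSet, Set.mem_ofPred_eq, simplePerm_zero_apply, Set.mem_insert_iff,
          Set.mem_singleton_iff]
        split_ifs <;> omega
      rw [this, Set.ncard_pair (by norm_num)]
      exact even_two
  | succ i =>
    refine ⟨fun k => ?_, ⟨i + 2, fun k hk => ?_⟩, ?_⟩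
    · simp only [simplePerm_succ_apply]
      split_ifs <;> omega
    · rw [simplePerm_succ_apply]
      push_cast at hk
      split_ifs <;> omega
    · have : negSet (simplePerm (i + 1)) = ∅ := by
        ext k
        simp only [negSet, Set.mem_ofPred_eq, simplePerm_succ_apply, Set.mem_empty_iff_false,
          iff_false]
        split_ifs <;> omega
      simp [this]

/-- The simple reflection `s_i` of `W̃_∞`, with `s_□` at index `0`. -/
def simple (i : ℕ) : WeylD := ⟨simplePerm i, isEvenSigned_simplePerm i⟩

theorem simple_mul_self (i : ℕ) : simple i * simple i = 1 := by
  apply Subtype.ext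
  ext k
  change simplePerm i (simplePerm i k) = k
  cases i with
  | zero => simp only [simplePerm_zero_apply]; grind
  | succ i => simp only [simplePerm_succ_apply]; grind

/-- The product `s_{a_1} ⋯ s_{a_ℓ}` of a word `a_1 ⋯ a_ℓ`. -/
def wordProd (l : List ℕ) : WeylD := (l.map simple).prod

theorem wordProd_append (l m : List ℕ) : wordProd (l ++ m) = wordProd l * wordProd m := by
  simp [wordProd]

theorem wordProd_cons (i : ℕ) (l : List ℕ) : wordProd (i :: l) = simple i * wordProd l := by
  simp [wordProd]

theorem exists_wordProd_inv (l : List ℕ) : ∃ m, wordProd m = (wordProd l)⁻¹ := by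
  induction l with
  | nil => exact ⟨[], by simp [wordProd]⟩
  | cons i l ih =>
    obtain ⟨m, hm⟩ := ih
    refine ⟨m ++ [i], ?_⟩
    have hs : (simple i)⁻¹ = simple i := inv_eq_of_mul_eq_one_left (simple_mul_self i)
    rw [wordProd_append, wordProd_cons i l, mul_inv_rev, hm, hs]
    simp [wordProd]

theorem exists_word_apply_pos (n : ℕ) (d : ℕ) (hd : d < n) :
    ∃ l : List ℕ, (∀ i : ℤ, (n : ℤ) < i → (wordProd l).1 i = i) ∧
      (wordProd l).1 n = (n : ℤ) - d := by
  induction d with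
  | zero => exact ⟨[], fun i _ => by simp [wordProd], by simp [wordProd]⟩
  | succ d ih =>
    obtain ⟨l, h1, h2⟩ := ih (by omega)
    obtain ⟨k, hk⟩ : ∃ k, n = d + 1 + (k + 1) := ⟨n - d - 2, by omega⟩
    refine ⟨(k + 1) :: l, fun i hi => ?_, ?_⟩
    · rw [wordProd_cons]
      change simplePerm (k + 1) ((wordProd l).1 i) = i
      rw [h1 i hi, simplePerm_succ_apply]
      split_ifs <;> omega
    · rw [wordProd_cons]
      change simplePerm (k + 1) ((wordProd l).1 n) = _
      rw [h2, simplePerm_succ_apply]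
      split_ifs <;> push_cast <;> omega

theorem exists_word_apply_neg (n : ℕ) (hn : 2 ≤ n) (d : ℕ) (hd : d < n) :
    ∃ l : List ℕ, (∀ i : ℤ, (n : ℤ) < i → (wordProd l).1 i = i) ∧
      (wordProd l).1 n = -((d : ℤ) + 1) := by
  induction d with
  | zero =>
    obtain ⟨l, h1, h2⟩ := exists_word_apply_pos n (n - 2) (by omega)
    refine ⟨0 :: l, fun i hi => ?_, ?_⟩
    · rw [wordProd_cons]
      change simplePerm 0 ((wordProd l).1 i) = i
      rw [h1 i hi, simplePerm_zero_apply]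
      split_ifs <;> omega
    · rw [wordProd_cons]
      change simplePerm 0 ((wordProd l).1 n) = _
      rw [h2, simplePerm_zero_apply]
      split_ifs <;> push_cast <;> omega
  | succ d ih =>
    obtain ⟨l, h1, h2⟩ := ih (by omega)
    refine ⟨(d + 1) :: l, fun i hi => ?_, ?_⟩
    · rw [wordProd_cons]
      change simplePerm (d + 1) ((wordProd l).1 i) = i
      rw [h1 i hi, simplePerm_succ_apply]
      split_ifs <;> omega
    · rw [wordProd_cons]
      change simplePerm (d + 1) ((wordProd l).1 n) = _
      rw [h2, simplePerm_succ_apply]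
      split_ifs <;> push_cast <;> omega

theorem exists_word_of_fixes (n : ℕ) :
    ∀ w : WeylD, (∀ i : ℤ, (n : ℤ) < i → w.1 i = i) → ∃ l, wordProd l = w := by
  have triv : ∀ w : WeylD, (∀ i : ℤ, 0 < i → w.1 i = i) → ∃ l, wordProd l = w := by
    intro w hw
    refine ⟨[], ?_⟩
    apply Subtype.ext
    ext i
    change i = w.1 i
    rcases lt_trichotomy i 0 with h | h | h
    · have h1 := hw (-i) (by omega)
      rw [w.2.1] at h1
      omega
    · rw [h, apply_zero w.2.1]
    · exact (hw i h).symm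
  induction n with
  | zero => exact fun w hw => triv w (by simpa using hw)
  | succ n ih =>
    intro w hw
    have hbd : ∀ j : ℤ, w.1 j = (n : ℤ) + 1 → j ≤ n + 1 ∧ -(n + 1) ≤ j := by
      intro j hj
      constructor
      · by_contra hlt
        have := hw j (by push_cast; omega)
        omega
      · by_contra hlt
        have := hw (-j) (by push_cast; omega)
        rw [w.2.1] at this
        omega
    have hj := Equiv.apply_symm_apply w.1 ((n : ℤ) + 1)
    set j := w.1.symm ((n : ℤ) + 1) with hjdef
    have hj0 : j ≠ 0 := fun h0 => by
      rw [h0, apply_zero w.2.1] at hj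
      omega
    obtain ⟨b1, b2⟩ := hbd j hj
    have fin : ∀ l : List ℕ, (∀ i : ℤ, ((n + 1 : ℕ) : ℤ) < i → (wordProd l).1 i = i) →
        (wordProd l).1 ((n + 1 : ℕ) : ℤ) = j → ∃ l, wordProd l = w := by
      intro l h1 h2
      obtain ⟨m, hm⟩ := ih (w * wordProd l) (fun i hi => by
        change w.1 ((wordProd l).1 i) = i
        by_cases hi' : i = ((n + 1 : ℕ) : ℤ)
        · rw [hi', h2, hj]
          push_cast
          rfl
        · have hlt : ((n + 1 : ℕ) : ℤ) < i := by push_cast at hi' ⊢; omega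
          rw [h1 i hlt, hw i hlt])
      obtain ⟨l', hl'⟩ := exists_wordProd_inv l
      exact ⟨m ++ l', by rw [wordProd_append, hm, hl', mul_inv_cancel_right]⟩
    rcases lt_or_gt_of_ne hj0 with hneg | hpos
    · by_cases hn : n = 0
      · subst hn
        exfalso
        have hj1 : j = -1 := by push_cast at b2; omega
        have hw1 : w.1 1 = -1 := by
          have h3 : w.1 (-1) = 1 := by rw [← hj1, hj]; rfl
          rw [w.2.1] at h3
          omega
        have hneg1 : negSet w.1 = {1} := by
          ext k
          simp only [negSet, Set.mem_ofPred_eq, Set.mem_singleton_iff]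
          constructor
          · rintro ⟨k1, k2⟩
            by_contra hk
            have := hw k (by push_cast; omega)
            omega
          · rintro rfl
            omega
        have := w.2.2.2
        rw [hneg1, Set.ncard_singleton] at this
        exact absurd this (by decide)
      · obtain ⟨l, h1, h2⟩ :=
          exists_word_apply_neg (n + 1) (by omega) ((-j - 1).toNat) (by omega)
        exact fin l h1 (by rw [h2]; omega)
    · obtain ⟨l, h1, h2⟩ := exists_word_apply_pos (n + 1) ((n + 1 - j).toNat) (by omega)
      exact fin l h1 (by rw [h2]; push_cast; omega)

/-- The simple reflections generate `W̃_∞`. -/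
theorem exists_word (w : WeylD) : ∃ l, wordProd l = w :=
  let ⟨n, hn⟩ := w.2.2.1
  exists_word_of_fixes n w hn

/-- The length of `w`: the least number of letters of a word with product `w`. -/
def length (w : WeylD) : ℕ := sInf {k | ∃ l : List ℕ, l.length = k ∧ wordProd l = w}

theorem exists_reduced_word (w : WeylD) : ∃ l : List ℕ, l.length = length w ∧ wordProd l = w :=
  Nat.sInf_mem (s := {k | ∃ l : List ℕ, l.length = k ∧ wordProd l = w})
    (let ⟨l, hl⟩ := exists_word w; ⟨l.length, l, rfl, hl⟩)

theorem length_wordProd_le (l : List ℕ) : length (wordProd l) ≤ l.length :=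
  Nat.sInf_le ⟨l, rfl, rfl⟩

theorem length_one : length 1 = 0 := Nat.le_zero.1 (length_wordProd_le [])

theorem length_mul_le (v w : WeylD) : length (v * w) ≤ length v + length w := by
  obtain ⟨l, hl, rfl⟩ := exists_reduced_word v
  obtain ⟨m, hm, rfl⟩ := exists_reduced_word w
  rw [← wordProd_append, ← hl, ← hm, ← List.length_append]
  exact length_wordProd_le _

/-- `w` has a descent at position `r ∈ {□, 1, 2, …}`. -/
def IsDescent (w : WeylD) (r : ℕ) : Prop := length (w * simple r) < length w

/-- `w` lies in the subgroup `S_∞` of `W̃_∞`. -/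
def IsTypeA (w : WeylD) : Prop := ∀ i : ℤ, 0 < i → 0 < w.1 i

/-- The least `n ≥ 2` such that `w` lies in `W̃_n`, i.e. such that `w` fixes all `i > n`. -/
def rank (w : WeylD) : ℕ := sInf {n | 2 ≤ n ∧ ∀ i : ℤ, (n : ℤ) < i → w.1 i = i}

theorem rank_spec (w : WeylD) : 2 ≤ rank w ∧ ∀ i : ℤ, (rank w : ℤ) < i → w.1 i = i := by
  obtain ⟨n, hn⟩ := w.2.2.1
  exact Nat.sInf_mem (s := {n | 2 ≤ n ∧ ∀ i : ℤ, (n : ℤ) < i → w.1 i = i})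
    ⟨n + 2, by omega, fun i hi => hn i (by push_cast at hi; omega)⟩

/-! ### The nilCoxeter algebra -/

/-- The bilinear extension of the product `u_v u_w = u_{vw}` if `ℓ(vw) = ℓ(v) + ℓ(w)` and
`u_v u_w = 0` otherwise. -/
def nilMul {R : Type} [CommRing R] (ξ η : WeylD →₀ R) : WeylD →₀ R :=
  ξ.sum fun v a => η.sum fun w b =>
    if length (v * w) = length v + length w then Finsupp.single (v * w) (a * b) else 0

section NilMul

variable {R : Type} [CommRing R]

theorem nilMul_single_single (v w : WeylD) (a b : R) :
    nilMul (Finsupp.single v a) (Finsupp.single w b) =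
      if length (v * w) = length v + length w then Finsupp.single (v * w) (a * b) else 0 := by
  unfold nilMul
  rw [Finsupp.sum_single_index, Finsupp.sum_single_index]
  · simp
  · exact Finset.sum_eq_zero fun w _ => by simp

theorem nilMul_zero_left (ξ : WeylD →₀ R) : nilMul 0 ξ = 0 := Finsupp.sum_zero_index

theorem nilMul_zero_right (ξ : WeylD →₀ R) : nilMul ξ 0 = 0 :=
  Finset.sum_eq_zero fun _ _ => Finsupp.sum_zero_index

theorem nilMul_add_left (ξ ξ' η : WeylD →₀ R) :
    nilMul (ξ + ξ') η = nilMul ξ η + nilMul ξ' η := by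
  refine Finsupp.sum_add_index' (fun v => ?_) (fun v a b => ?_)
  · exact Finset.sum_eq_zero fun w _ => by simp
  · rw [← Finsupp.sum_add]
    refine Finset.sum_congr rfl fun w _ => ?_
    dsimp only
    split_ifs
    · rw [add_mul, Finsupp.single_add]
    · rw [add_zero]

theorem nilMul_add_right (ξ η η' : WeylD →₀ R) :
    nilMul ξ (η + η') = nilMul ξ η + nilMul ξ η' := by
  unfold nilMul
  rw [← Finsupp.sum_add]
  refine Finset.sum_congr rfl fun v _ => ?_
  refine Finsupp.sum_add_index' (fun w => by simp) (fun w a b => ?_)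
  split_ifs
  · rw [mul_add, Finsupp.single_add]
  · rw [add_zero]

theorem nilMul_assoc (ξ η ζ : WeylD →₀ R) :
    nilMul (nilMul ξ η) ζ = nilMul ξ (nilMul η ζ) := by
  induction ξ using Finsupp.induction_linear with
  | zero => simp only [nilMul_zero_left]
  | add ξ ξ' h h' => simp only [nilMul_add_left, h, h']
  | single u a =>
  induction η using Finsupp.induction_linear with
  | zero => simp only [nilMul_zero_left, nilMul_zero_right]
  | add η η' h h' => simp only [nilMul_add_left, nilMul_add_right, h, h']
  | single v b =>
  induction ζ using Finsupp.induction_linear with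
  | zero => simp only [nilMul_zero_right]
  | add ζ ζ' h h' => simp only [nilMul_add_right, h, h']
  | single w c =>
  have h1 := length_mul_le u v
  have h2 := length_mul_le v w
  have h3 := length_mul_le (u * v) w
  have h4 := length_mul_le u (v * w)
  rw [nilMul_single_single, nilMul_single_single]
  rw [mul_assoc] at h3
  split_ifs with h5 h6 h6 <;>
    simp only [nilMul_single_single, nilMul_zero_left, nilMul_zero_right, mul_assoc]
  · split_ifs <;> first | rfl | omega
  · split_ifs <;> first | rfl | omega
  · split_ifs <;> first | rfl | omega

theorem nilMul_one_left (ξ : WeylD →₀ R) : nilMul (Finsupp.single 1 1) ξ = ξ := by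
  induction ξ using Finsupp.induction_linear with
  | zero => exact nilMul_zero_right _
  | add ξ η h h' => rw [nilMul_add_right, h, h']
  | single w c => simp [nilMul_single_single, length_one]

theorem nilMul_one_right (ξ : WeylD →₀ R) : nilMul ξ (Finsupp.single 1 1) = ξ := by
  induction ξ using Finsupp.induction_linear with
  | zero => exact nilMul_zero_left _
  | add ξ η h h' => rw [nilMul_add_left, h, h']
  | single w c => simp [nilMul_single_single, length_one]

end NilMul

/-- The nilCoxeter algebra of `W̃_∞` with coefficients in `R`: the free module on the basis
`u_w`, `w ∈ W̃_∞`, with `u_v u_w = u_{vw}` if `ℓ(vw) = ℓ(v) + ℓ(w)` and `u_v u_w = 0` otherwise.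
The nilCoxeter algebras of `W̃_n` and of `S_n` are the subalgebras generated by the `u_i` for which
`s_i` lies in the respective group. -/
def NilCoxeter (R : Type) [CommRing R] : Type := WeylD →₀ R

namespace NilCoxeter

variable {R : Type} [CommRing R]

instance : AddCommGroup (NilCoxeter R) := inferInstanceAs (AddCommGroup (WeylD →₀ R))

instance : Ring (NilCoxeter R) :=
  { (inferInstance : AddCommGroup (NilCoxeter R)) with
    mul := nilMul
    one := Finsupp.single 1 1
    zero_mul := nilMul_zero_left
    mul_zero := nilMul_zero_right
    left_distrib := nilMul_add_right
    right_distrib := nilMul_add_left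
    mul_assoc := nilMul_assoc
    one_mul := nilMul_one_left
    mul_one := nilMul_one_right }

/-- The element `c u_w`. -/
def single (w : WeylD) (c : R) : NilCoxeter R := Finsupp.single w c

/-- The coefficient `⟨ξ, w⟩` of `u_w` in `ξ`. -/
def coeff (ξ : NilCoxeter R) (w : WeylD) : R := (show WeylD →₀ R from ξ) w

theorem single_mul_single (v w : WeylD) (a b : R) : single v a * single w b =
    if length (v * w) = length v + length w then single (v * w) (a * b) else 0 :=
  nilMul_single_single v w a b

/-- The product of `u_{a_1}, …, u_{a_ℓ}` is `u_w` if `a_1 ⋯ a_ℓ` is a reduced word of `w`, and `0`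
if the word is not reduced. -/
theorem prod_single_simple (l : List ℕ) :
    (l.map fun i => single (simple i) (1 : R)).prod =
      if length (wordProd l) = l.length then single (wordProd l) 1 else 0 := by
  induction l with
  | nil =>
    have h0 : length (wordProd []) = ([] : List ℕ).length := length_one
    rw [if_pos h0]
    rfl
  | cons i l ih =>
    have h1 := length_wordProd_le l
    have h2 := length_wordProd_le [i]
    have h3 : wordProd [i] = simple i := by simp [wordProd]
    have h4 := length_mul_le (simple i) (wordProd l)
    have h5 : length (simple i) ≠ 0 := by
      obtain ⟨m, hm, hm'⟩ := exists_reduced_word (simple i)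
      intro h0
      rw [h0, List.length_eq_zero_iff] at hm
      subst hm
      have h6 : simplePerm i ((i : ℤ) + 1) = (i : ℤ) + 1 :=
        (congrArg (fun v : WeylD => v.1 ((i : ℤ) + 1)) hm').symm
      have h7 : simplePerm i (i : ℤ) = (i : ℤ) :=
        (congrArg (fun v : WeylD => v.1 (i : ℤ)) hm').symm
      cases i with
      | zero => rw [simplePerm_zero_apply] at h6; simp at h6
      | succ i => rw [simplePerm_succ_apply] at h7; push_cast at h7; simp at h7
    rw [h3] at h2
    simp only [List.length_cons, List.length_nil] at h2
    rw [List.map_cons, List.prod_cons, ih, wordProd_cons, List.length_cons]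
    by_cases h : length (wordProd l) = l.length
    · rw [if_pos h, single_mul_single, mul_one]
      split_ifs <;> first | rfl | omega
    · rw [if_neg h, mul_zero, if_neg (by omega)]

end NilCoxeter

/-! ### Schubert polynomials and Stanley functions -/

/-- The variables `x_i`, `y_i`, `z_i`; only the indices `i ≥ 1` are used. -/
inductive Var : Type
  | x (i : ℕ) : Var
  | y (i : ℕ) : Var
  | z (i : ℕ) : Var

/-- Formal power series with integer coefficients in all the variables `x_i`, `y_i`, `z_i`. -/
abbrev Series : Type := MvPowerSeries Var ℤ

/-- The factor `1 + t u_i` (with `u_□` at index `0`). -/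
def factor (i : ℕ) (t : Series) : NilCoxeter Series := 1 + NilCoxeter.single (simple i) t

/-- `A_i(t) = (1 + t u_{n-1}) (1 + t u_{n-2}) ⋯ (1 + t u_i)`. -/
def opA (n i : ℕ) (t : Series) : NilCoxeter Series :=
  ((List.range' i (n - i)).reverse.map fun j => factor j t).prod

/-- `Ã_i(t) = (1 - t u_i) (1 - t u_{i+1}) ⋯ (1 - t u_{n-1})`. -/
def opA' (n i : ℕ) (t : Series) : NilCoxeter Series :=
  ((List.range' i (n - i)).map fun j => factor j (-t)).prod

/-- `D(t) = (1 + t u_{n-1}) ⋯ (1 + t u_1) (1 + t u_□) (1 + t u_2) ⋯ (1 + t u_{n-1})`. -/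
def opD (n : ℕ) (t : Series) : NilCoxeter Series :=
  opA n 1 t * factor 0 t * ((List.range' 2 (n - 2)).map fun j => factor j t).prod

def varX (i : ℕ) : Series := MvPowerSeries.X (Var.x i)
def varY (i : ℕ) : Series := MvPowerSeries.X (Var.y i)
def varZ (i : ℕ) : Series := MvPowerSeries.X (Var.z i)

/-- The product `D(x_1) ⋯ D(x_N)`. -/
def prodD (n N : ℕ) : NilCoxeter Series :=
  ((List.range' 1 N).map fun i => opD n (varX i)).prod

/-- The index of a variable `x_i`, and `0` for the other variables. -/
def xIndex : Var → ℕ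
  | Var.x i => i
  | Var.y _ => 0
  | Var.z _ => 0

/-- The power series in infinitely many variables `x_1, x_2, …` whose truncation to `x_1, …, x_N`
is `f N` for all `N`: the coefficient of a monomial `m` is read off from `f N`, where `x_N` is the
last `x`-variable in `m`. For `f N = ⟨ξ D(x_1) ⋯ D(x_N) η, w⟩`, with `ξ` and `η` free of the
`x`-variables, this is `⟨ξ D(X) η, w⟩` with the infinite product `D(X) = D(x_1) D(x_2) ⋯`. -/
def xLimit (f : ℕ → Series) : Series := fun m => MvPowerSeries.coeff m (f (m.support.sup xIndex))

/-- The type D double Schubert polynomial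
`𝔇_w(X; Y, Z) = ⟨Ã_{n-1}(z_{n-1}) ⋯ Ã_1(z_1) D(X) A_1(y_1) ⋯ A_{n-1}(y_{n-1}), w⟩`,
`w ∈ W̃_n`. -/
def doubleSchubert (w : WeylD) : Series :=
  xLimit fun N =>
    (((List.range' 1 (rank w - 1)).reverse.map fun i => opA' (rank w) i (varZ i)).prod *
      prodD (rank w) N *
      ((List.range' 1 (rank w - 1)).map fun i => opA (rank w) i (varY i)).prod).coeff w

/-- The type A double Stanley symmetric function `G_u(Y/Z) = ⟨Ã(Z) A(Y), u⟩` for `u ∈ S_∞`, where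
`A(Y) = A_1(y_{i_1}) A_1(y_{i_2}) ⋯` and `Ã(Z) = Ã_1(z_{j_1}) Ã_1(z_{j_2}) ⋯`; the lists `I` and
`J` contain the indices of the variables in the finite alphabets `Y` and `Z`. -/
def stanleyG (u : WeylD) (I J : List ℕ) : Series :=
  ((J.map fun j => opA' (rank u) 1 (varZ j)).prod *
    (I.map fun i => opA (rank u) 1 (varY i)).prod).coeff u

/-- The type D double mixed Stanley function `I_u(X; Y/Z) = ⟨Ã(Z) D(X) A(Y), u⟩`, where the lists
`I` and `J` contain the indices of the variables in the finite alphabets `Y` and `Z`. -/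
def stanleyI (u : WeylD) (I J : List ℕ) : Series :=
  xLimit fun N =>
    ((J.map fun j => opA' (rank u) 1 (varZ j)).prod * prodD (rank u) N *
      (I.map fun i => opA (rank u) 1 (varY i)).prod).coeff u

/-! ### Compatible factorizations -/

/-- `w` is compatible with the sequence `a_1, …, a_p`: all its descent positions occur in it. -/
def IsCompatible (w : WeylD) (p : ℕ) (a : ℕ → ℕ) : Prop :=
  ∀ r, IsDescent w r → ∃ i, 1 ≤ i ∧ i ≤ p ∧ a i = r

/-- The indices `a_{i-1} + 1, …, a_i` of the variables in the `i`-th alphabet of a sequence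
`a_1 < a_2 < ⋯`, where `a_0 = 0` (and `□ = 0`). -/
def block (a : ℕ → ℕ) (i : ℕ) : List ℕ :=
  let start := if i ≤ 1 then 0 else a (i - 1)
  List.range' (start + 1) (a i - start)

/-- `u_1 ⋯ u_m = w` is a reduced factorization; the factor `u_{j+1}` is `u j`. -/
def IsReducedFactorization {m : ℕ} (u : Fin m → WeylD) (w : WeylD) : Prop :=
  (List.ofFn u).prod = w ∧ ∑ j, length (u j) = length w

/-- The reduced factorizations `u_1 ⋯ u_{p+q-1} = w` compatible with `a_1 < ⋯ < a_p` and
`b_1 < ⋯ < b_q`. -/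
def compatibleFactorizations (w : WeylD) (p q : ℕ) (a b : ℕ → ℕ) :
    Set (Fin (p + q - 1) → WeylD) :=
  {u | IsReducedFactorization u w ∧
    ∀ k : Fin (p + q - 1), let j : ℕ := k + 1
      (j ≠ q → IsTypeA (u k)) ∧
      (j < q → ∀ i : ℕ, 1 ≤ i → i ≤ b (q - j) → (u k).1 i = i) ∧
      (q < j → ∀ i : ℕ, 1 ≤ i → i ≤ a (j - q) → (u k).1 i = i)}

/-- The product
`G_{u_1}(0/Z_q) ⋯ G_{u_{q-1}}(0/Z_2) I_{u_q}(X; Y_1/Z_1) G_{u_{q+1}}(Y_2) ⋯ G_{u_{p+q-1}}(Y_p)`. -/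
def splittingTerm (p q : ℕ) (a b : ℕ → ℕ) (u : Fin (p + q - 1) → WeylD) : Series :=
  ∏ k : Fin (p + q - 1), let j : ℕ := k + 1
    if j < q then stanleyG (u k) [] (block b (q + 1 - j))
    else if j = q then stanleyI (u k) (block a 1) (block b 1)
    else stanleyG (u k) (block a (j - q + 1)) []

end TypeDSchubert

end

noncomputable section

namespace TypeDSchubert

/-! If `r` is not a descent of `w`, right multiplication by `1 + t u_r` does not change the
coefficient of `u_w`, because every basis element occurring in `ξ u_r` has a descent at `r`
(`coeff_mul_factor`). Let `c = a_{i-1} + 1`. For `c ≤ j ≤ a_i`, the operator `A_j(y_j)` may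
therefore be replaced by `A_c(y_j)`: the extra factors, with letters `c ≤ r < j`, stand at its right
end, commute past all later operators, and are absorbed since no such `r` is a descent. Operators
after `a_p` are absorbed entirely. This regroups `A_1(y_1) ⋯ A_{n-1}(y_{n-1})` into one product per
alphabet `Y_i` (`coeff_mul_tailA_eq`).

The anti-automorphism `u_w ↦ u_{w⁻¹}` transfers this to the `z`-side. It reverses the order inside
each alphabet, which is harmless because `A_c(s)` and `A_c(t)` commute, a consequence of the
Yang–Baxter equation (`opA_commute`, `coeff_headA'_mul_eq`).

The result is a product of `p + q - 1` elements, whose coefficient is a sum over reduced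
factorizations of products of coefficients (`coeff_prod_ofFn`). Killing all `u_v` with `v` outside a
parabolic subgroup is a ring homomorphism (`proj`). It carries `A_1` to `A_c`, so the coefficients
in the outer factors are Stanley functions on the compatible `u_j` and vanish on the others; it also
gives independence of `n`, and parabolicity gives finiteness.

All this is done with `x_1, …, x_N`; `xLimit` then passes to infinitely many variables, as it
commutes with finite sums and with multiplication by series free of `x`. -/

/-! ### Descents and parabolic subgroups -/

/-- The smaller entry of the pair of integers exchanged by `s_r`. -/
def lo : ℕ → ℤ
  | 0 => -2
  | (i + 1) => (i : ℤ) + 1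

/-- The larger entry of the pair of integers exchanged by `s_r`. -/
def hi : ℕ → ℤ
  | 0 => 1
  | (i + 1) => (i : ℤ) + 2

theorem lo_lt_hi (r : ℕ) : lo r < hi r := by
  cases r <;> simp [lo, hi]

theorem lo_ne_zero (r : ℕ) : lo r ≠ 0 := by
  cases r <;> simp only [lo] <;> omega

theorem hi_ne_zero (r : ℕ) : hi r ≠ 0 := by
  cases r <;> simp only [hi] <;> omega

theorem lo_ne_neg_hi (r : ℕ) : lo r ≠ -hi r := by
  cases r <;> simp only [lo, hi] <;> omega

theorem simplePerm_eq (r : ℕ) :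
    simplePerm r = Equiv.swap (lo r) (hi r) * Equiv.swap (-lo r) (-hi r) := by
  cases r with
  | zero => simp [simplePerm, lo, hi, Equiv.swap_comm]
  | succ i => rfl

/-- The two transpositions are disjoint and commute. This form fits the case of
`simple_mul_eq_mul_simple` in which the root of `s_r` is represented by the pair `(-hi r, -lo r)`.
-/
theorem simplePerm_eq' (r : ℕ) :
    simplePerm r = Equiv.swap (-hi r) (-lo r) * Equiv.swap (hi r) (lo r) := by
  rw [simplePerm_eq]
  ext k
  have h1 := lo_lt_hi r
  have h2 := lo_ne_zero r
  have h3 := hi_ne_zero r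
  have h4 := lo_ne_neg_hi r
  simp only [Equiv.Perm.mul_apply, Equiv.swap_apply_def]
  split_ifs <;> omega

theorem simplePerm_lo (r : ℕ) : simplePerm r (lo r) = hi r := by
  cases r with
  | zero => simp [lo, hi, simplePerm_zero_apply]
  | succ i => simp [lo, hi, simplePerm_succ_apply]

theorem simplePerm_hi (r : ℕ) : simplePerm r (hi r) = lo r := by
  cases r with
  | zero => simp [lo, hi, simplePerm_zero_apply]
  | succ i => simp [lo, hi, simplePerm_succ_apply]

/-- A simple reflection makes only its own positive root negative. -/
theorem eq_of_simplePerm_lt {r : ℕ} {i j : ℤ} (hij : i < j) (hi0 : i ≠ 0) (hj0 : j ≠ 0)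
    (hn : i ≠ -j) (h : simplePerm r j < simplePerm r i) :
    (i = lo r ∧ j = hi r) ∨ (i = -hi r ∧ j = -lo r) := by
  cases r with
  | zero =>
    simp only [simplePerm_zero_apply, lo, hi] at h ⊢
    split_ifs at h <;> omega
  | succ r =>
    simp only [simplePerm_succ_apply, lo, hi] at h ⊢
    split_ifs at h <;> omega

/-- When the letters act one at a time from the right, some letter must reverse the order of the two
images, and a simple reflection reverses only its own pair. -/
theorem exists_root_in_word (l : List ℕ) {i j : ℤ} (hij : i < j) (hi0 : i ≠ 0) (hj0 : j ≠ 0)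
    (hn : i ≠ -j) (h : (wordProd l).1 j < (wordProd l).1 i) :
    ∃ l₁ r l₂, l = l₁ ++ r :: l₂ ∧
      (((wordProd l₂).1 i = lo r ∧ (wordProd l₂).1 j = hi r) ∨
        ((wordProd l₂).1 i = -hi r ∧ (wordProd l₂).1 j = -lo r)) := by
  induction l with
  | nil =>
    change j < i at h
    omega
  | cons r l ih =>
    rcases lt_trichotomy ((wordProd l).1 j) ((wordProd l).1 i) with h' | h' | h'
    · obtain ⟨l₁, r', l₂, rfl, h2⟩ := ih h'
      exact ⟨r :: l₁, r', l₂, rfl, h2⟩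
    · exact absurd ((wordProd l).1.injective h') hij.ne'
    · have os := (wordProd l).2.1
      refine ⟨[], r, l, rfl, eq_of_simplePerm_lt h' (apply_ne_zero os hi0) (apply_ne_zero os hj0)
        (fun e => hn ?_) ?_⟩
      · rw [← os] at e
        exact (wordProd l).1.injective e
      · rw [wordProd_cons] at h
        exact h

/-- Conjugating `s_s` by `v` transposes the images under `v` of the entries that `s_s` transposes.
-/
theorem simple_mul_eq_mul_simple {v : WeylD} {r s : ℕ}
    (h : (v.1 (lo s) = lo r ∧ v.1 (hi s) = hi r) ∨ (v.1 (lo s) = -hi r ∧ v.1 (hi s) = -lo r)) :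
    simple r * v = v * simple s := by
  have key : v.1 * simplePerm s = simplePerm r * v.1 := by
    have e : simplePerm r = Equiv.swap (v.1 (lo s)) (v.1 (hi s)) *
        Equiv.swap (v.1 (-lo s)) (v.1 (-hi s)) := by
      rw [v.2.1, v.2.1]
      rcases h with ⟨h1, h2⟩ | ⟨h1, h2⟩
      · rw [h1, h2, simplePerm_eq]
      · rw [h1, h2, simplePerm_eq', neg_neg, neg_neg]
    rw [e, simplePerm_eq, Equiv.swap_apply_apply, Equiv.swap_apply_apply]
    group
  exact Subtype.ext key.symm

theorem length_simple_le (r : ℕ) : length (simple r) ≤ 1 := by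
  have := length_wordProd_le [r]
  simpa [wordProd] using this

/-- Exchange argument: otherwise `w s_r` inverts the pair of `s_r`, so a letter can be deleted from
a reduced word of `w s_r` to give a word of `w`, making `w` shorter than `w s_r`. -/
theorem IsDescent.lt {w : WeylD} {r : ℕ} (h : IsDescent w r) : w.1 (hi r) < w.1 (lo r) := by
  by_contra hlt
  have hne : w.1 (lo r) ≠ w.1 (hi r) := fun e => (lo_lt_hi r).ne (w.1.injective e)
  obtain ⟨l, hl, hw⟩ := exists_reduced_word (w * simple r)
  have h1 : (w * simple r).1 (lo r) = w.1 (hi r) := congrArg w.1 (simplePerm_lo r)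
  have h2 : (w * simple r).1 (hi r) = w.1 (lo r) := congrArg w.1 (simplePerm_hi r)
  obtain ⟨l₁, x, l₂, rfl, h3⟩ := exists_root_in_word l (lo_lt_hi r) (lo_ne_zero r) (hi_ne_zero r)
    (lo_ne_neg_hi r) (by rw [hw, h1, h2]; omega)
  have h4 := simple_mul_eq_mul_simple h3
  have h5 : w = wordProd (l₁ ++ l₂) := by
    rw [wordProd_append, wordProd_cons, h4, ← mul_assoc] at hw
    rw [wordProd_append]
    exact (mul_right_cancel hw).symm
  have h6 := length_wordProd_le (l₁ ++ l₂)
  rw [← h5] at h6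
  unfold IsDescent at h
  simp only [List.length_append, List.length_cons] at hl h6
  omega

theorem length_inv_le (w : WeylD) : length w⁻¹ ≤ length w := by
  obtain ⟨l, hl, rfl⟩ := exists_reduced_word w
  have : (wordProd l)⁻¹ = wordProd l.reverse := by
    clear hl
    induction l with
    | nil => simp [wordProd]
    | cons i l ih =>
      have hs : (simple i)⁻¹ = simple i := inv_eq_of_mul_eq_one_left (simple_mul_self i)
      rw [List.reverse_cons, wordProd_append, wordProd_cons, mul_inv_rev, ih, hs]
      simp [wordProd]
  rw [this, ← hl, ← List.length_reverse]
  exact length_wordProd_le _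

theorem length_inv (w : WeylD) : length w⁻¹ = length w :=
  le_antisymm (length_inv_le w) (by simpa using length_inv_le w⁻¹)

/-- A subgroup which contains the simple reflections at the descents of its elements. -/
def IsParabolic (H : Subgroup WeylD) : Prop :=
  ∀ w ∈ H, ∀ r, IsDescent w r → simple r ∈ H

/-- Since lengths add, the last letter of a reduced word of `w` is a descent of `v w`. Its
reflection thus lies in `H` and can be stripped off. -/
theorem IsParabolic.right_mem {H : Subgroup WeylD} (hH : IsParabolic H) {v w : WeylD}
    (hl : length (v * w) = length v + length w) (h : v * w ∈ H) : w ∈ H := by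
  obtain ⟨l, hlen, rfl⟩ := exists_reduced_word w
  induction l using List.reverseRecOn with
  | nil => exact H.one_mem
  | append_singleton l r ih =>
    have e : wordProd (l ++ [r]) = wordProd l * simple r := by simp [wordProd]
    have h1 := length_simple_le r
    have h2 := length_mul_le (wordProd l) (simple r)
    have h3 := length_wordProd_le l
    have h4 := length_mul_le v (wordProd l)
    have h5 := length_mul_le (v * wordProd l) (simple r)
    rw [mul_assoc] at h5
    rw [e] at hl h hlen ⊢
    simp only [List.length_append, List.length_singleton] at hlen
    have h6 : v * (wordProd l * simple r) * simple r = v * wordProd l := by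
      rw [mul_assoc, mul_assoc, simple_mul_self, mul_one]
    have hr : simple r ∈ H := hH _ h r (by
      unfold IsDescent
      rw [h6]
      omega)
    refine H.mul_mem (ih (by omega) ?_ (by omega)) hr
    rw [← h6]
    exact H.mul_mem h hr

theorem IsParabolic.left_mem {H : Subgroup WeylD} (hH : IsParabolic H) {v w : WeylD}
    (hl : length (v * w) = length v + length w) (h : v * w ∈ H) : v ∈ H :=
  (H.mul_mem_cancel_right (hH.right_mem hl h)).1 h

/-! ### The two families of parabolic subgroups -/

/-- The subgroup `W̃_n` of `W̃_∞`. -/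
def weylSubgroup (n : ℕ) : Subgroup WeylD where
  carrier := {w | ∀ i : ℤ, (n : ℤ) < i → w.1 i = i}
  mul_mem' := fun {v _} hv hw i hi => (congrArg v.1 (hw i hi)).trans (hv i hi)
  one_mem' := fun _ _ => rfl
  inv_mem' := fun {w} hw i hi => (Equiv.symm_apply_eq w.1).2 (hw i hi).symm

theorem abs_apply_le {n : ℕ} {w : WeylD} (hw : w ∈ weylSubgroup n) {i : ℤ} (hi : |i| ≤ n) :
    |w.1 i| ≤ n := by
  by_contra h
  have h0 := apply_zero w.2.1
  rcases le_or_gt 0 (w.1 i) with h1 | h1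
  · rw [abs_of_nonneg h1] at h
    have := w.1.injective (hw (w.1 i) (by omega))
    rw [abs_le] at hi
    omega
  · rw [abs_of_neg h1] at h
    have h2 := hw (-w.1 i) (by omega)
    rw [← w.2.1] at h2
    have := w.1.injective h2
    have h3 := w.2.1 i
    rw [abs_le] at hi
    omega

theorem simple_mem_weylSubgroup {n r : ℕ} (hn : 2 ≤ n) : simple r ∈ weylSubgroup n ↔ r < n := by
  constructor
  · intro h
    by_contra hr
    obtain ⟨k, rfl⟩ : ∃ k, r = k + 1 := ⟨r - 1, by omega⟩
    have := h (k + 2) (by omega)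
    change simplePerm (k + 1) _ = _ at this
    rw [simplePerm_succ_apply] at this
    split_ifs at this <;> omega
  · intro hr i hi
    change simplePerm r i = i
    cases r with
    | zero =>
      rw [simplePerm_zero_apply]
      split_ifs <;> omega
    | succ r =>
      rw [simplePerm_succ_apply]
      split_ifs <;> omega

/-- For `r ≥ n` the entry `r + 1` is fixed, while the entry at `r` has absolute value at most `r`,
so there is no descent at `r`. -/
theorem isParabolic_weylSubgroup {n : ℕ} (hn : 2 ≤ n) : IsParabolic (weylSubgroup n) := by
  intro w hw r hr
  rw [simple_mem_weylSubgroup hn]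
  by_contra h
  have h1 := hr.lt
  obtain ⟨k, rfl⟩ : ∃ k, r = k + 1 := ⟨r - 1, by omega⟩
  have h2 : w.1 (hi (k + 1)) = k + 2 := hw (k + 2) (by omega)
  have h3 : |w.1 (lo (k + 1))| ≤ ((k + 1 : ℕ) : ℤ) :=
    abs_apply_le (fun i hi => hw i (by omega)) (by simp only [lo]; rw [abs_le]; omega)
  rw [abs_le] at h3
  omega

theorem finite_weylSubgroup (n : ℕ) : (weylSubgroup n : Set WeylD).Finite := by
  let f : WeylD → Set.Icc (-(n : ℤ)) n → ℤ := fun w i => w.1 i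
  refine Set.Finite.of_finite_image (f := f) ?_ ?_
  · refine (Set.Finite.pi' fun _ : Set.Icc (-(n : ℤ)) n => Set.finite_Icc (-(n : ℤ)) n).subset ?_
    rintro _ ⟨w, hw, rfl⟩ i
    have := abs_apply_le hw (abs_le.2 i.2)
    exact abs_le.1 this
  · intro v hv w hw h
    apply Subtype.ext
    ext i
    rcases lt_or_ge (n : ℤ) i with h1 | h1
    · rw [hv i h1, hw i h1]
    rcases lt_or_ge i (-(n : ℤ)) with h2 | h2
    · have h3 := hv (-i) (by omega)
      have h4 := hw (-i) (by omega)
      rw [v.2.1] at h3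
      rw [w.2.1] at h4
      omega
    · exact congrFun h ⟨i, h2, h1⟩

theorem mem_weylSubgroup_rank (w : WeylD) : w ∈ weylSubgroup (rank w) := (rank_spec w).2

theorem rank_le {n : ℕ} (hn : 2 ≤ n) {w : WeylD} (hw : w ∈ weylSubgroup n) : rank w ≤ n :=
  Nat.sInf_le ⟨hn, hw⟩

/-- The subgroup of the permutations in `S_∞` which fix `1, …, c`. -/
def permSubgroup (c : ℕ) : Subgroup WeylD where
  carrier := {w | IsTypeA w ∧ ∀ i : ℕ, 1 ≤ i → i ≤ c → w.1 i = i}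
  mul_mem' := fun {v _} hv hw => ⟨fun i hi => hv.1 _ (hw.1 i hi), fun i h1 h2 =>
    (congrArg v.1 (hw.2 i h1 h2)).trans (hv.2 i h1 h2)⟩
  one_mem' := ⟨fun _ hi => hi, fun _ _ _ => rfl⟩
  inv_mem' := fun {w} hw => by
    refine ⟨fun i hi => ?_, fun i h1 h2 => (Equiv.symm_apply_eq w.1).2 (hw.2 i h1 h2).symm⟩
    change 0 < w.1.symm i
    have h0 := Equiv.apply_symm_apply w.1 i
    by_contra h
    rcases (not_lt.1 h).eq_or_lt with h1 | h1
    · rw [h1, apply_zero w.2.1] at h0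
      omega
    · have h2 := hw.1 (-w.1.symm i) (by omega)
      rw [w.2.1] at h2
      omega

theorem simple_mem_permSubgroup {c r : ℕ} : simple r ∈ permSubgroup c ↔ c < r := by
  constructor
  · intro h
    by_contra hr
    cases r with
    | zero =>
      have := h.1 1 one_pos
      change 0 < simplePerm 0 1 at this
      rw [simplePerm_zero_apply] at this
      simp at this
    | succ r =>
      have := h.2 (r + 1) (by omega) (by omega)
      change simplePerm (r + 1) _ = _ at this
      rw [simplePerm_succ_apply] at this
      push_cast at this
      split_ifs at this <;> omega
  · intro hr
    obtain ⟨k, rfl⟩ : ∃ k, r = k + 1 := ⟨r - 1, by omega⟩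
    refine ⟨fun i hi => ?_, fun i h1 h2 => ?_⟩
    · change 0 < simplePerm (k + 1) i
      rw [simplePerm_succ_apply]
      split_ifs <;> omega
    · change simplePerm (k + 1) i = i
      rw [simplePerm_succ_apply]
      split_ifs <;> omega

/-- A descent at `□` would need `w_1 + w_2 < 0`. A descent at `1 ≤ r ≤ c` would need a positive
`w_{r+1} < r`, but those values are already taken by fixed points. -/
theorem isParabolic_permSubgroup (c : ℕ) : IsParabolic (permSubgroup c) := by
  intro w hw r hr
  rw [simple_mem_permSubgroup]
  by_contra h
  have h1 := hr.lt
  cases r with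
  | zero =>
    have h2 := hw.1 1 one_pos
    have h3 := hw.1 2 two_pos
    simp only [lo, hi] at h1
    rw [w.2.1] at h1
    omega
  | succ k =>
    have h2 : w.1 (lo (k + 1)) = k + 1 := hw.2 (k + 1) (by omega) (by omega)
    rw [h2] at h1
    have h3 : 0 < w.1 (hi (k + 1)) := hw.1 _ (by simp only [hi]; omega)
    obtain ⟨m, hm⟩ := Int.eq_ofNat_of_zero_le h3.le
    have h4 := hw.2 m (by omega) (by omega)
    rw [← hm] at h4
    have := w.1.injective h4
    simp only [hi] at this h1
    omega

/-! ### Structure of the nilCoxeter algebra -/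

theorem length_prod_ofFn_le {m : ℕ} (u : Fin m → WeylD) :
    length (List.ofFn u).prod ≤ ∑ k, length (u k) := by
  induction m with
  | zero => simp [length_one]
  | succ m ih =>
    rw [List.ofFn_succ, List.prod_cons, Fin.sum_univ_succ]
    exact (length_mul_le _ _).trans (Nat.add_le_add_left (ih _) _)

theorem IsReducedFactorization.mem {H : Subgroup WeylD} (hH : IsParabolic H) {m : ℕ}
    {u : Fin m → WeylD} {w : WeylD} (h : IsReducedFactorization u w) (hw : w ∈ H) (k : Fin m) :
    u k ∈ H := by
  induction m generalizing w with
  | zero => exact k.elim0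
  | succ m ih =>
    obtain ⟨rfl, h2⟩ := h
    have h3 := length_prod_ofFn_le fun k => u k.succ
    rw [List.ofFn_succ, List.prod_cons] at h2 hw
    rw [Fin.sum_univ_succ] at h2
    have h4 := length_mul_le (u 0) (List.ofFn fun k => u k.succ).prod
    have hl : length (u 0 * (List.ofFn fun k => u k.succ).prod) =
      length (u 0) + length (List.ofFn fun k => u k.succ).prod := by omega
    induction k using Fin.cases with
    | zero => exact hH.left_mem hl hw
    | succ k => exact ih ⟨rfl, by omega⟩ (hH.right_mem hl hw) k

namespace NilCoxeter

variable {R : Type} [CommRing R]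

@[ext]
theorem ext {ξ η : NilCoxeter R} (h : ∀ w, ξ.coeff w = η.coeff w) : ξ = η := Finsupp.ext h

@[simp]
theorem coeff_zero (w : WeylD) : (0 : NilCoxeter R).coeff w = 0 := rfl

@[simp]
theorem coeff_add (ξ η : NilCoxeter R) (w : WeylD) :
    (ξ + η).coeff w = ξ.coeff w + η.coeff w := rfl

theorem coeff_single (v w : WeylD) (a : R) [Decidable (v = w)] :
    (single v a).coeff w = if v = w then a else 0 := by
  classical
  change (Finsupp.single v a) w = _
  rw [Finsupp.single_apply]

theorem one_def : (1 : NilCoxeter R) = single 1 1 := rfl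

theorem single_add (v : WeylD) (a b : R) : single v (a + b) = single v a + single v b :=
  Finsupp.single_add v a b

theorem single_zero (v : WeylD) : single v (0 : R) = 0 := Finsupp.single_zero v

/-- The coefficient of `u_w` as an additive map. -/
def coeffHom (w : WeylD) : NilCoxeter R →+ R where
  toFun ξ := ξ.coeff w
  map_zero' := rfl
  map_add' _ _ := rfl

theorem coeff_sum {ι : Type*} (s : Finset ι) (f : ι → NilCoxeter R) (w : WeylD) :
    (∑ i ∈ s, f i).coeff w = ∑ i ∈ s, (f i).coeff w := map_sum (coeffHom w) f s

theorem induction_linear {P : NilCoxeter R → Prop} (ξ : NilCoxeter R) (zero : P 0)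
    (add : ∀ ξ η, P ξ → P η → P (ξ + η)) (single : ∀ w a, P (single w a)) : P ξ :=
  Finsupp.induction_linear (motive := P) ξ zero (fun ξ η => add ξ η) single

/-- The support of an element. -/
def support (ξ : NilCoxeter R) : Finset WeylD := Finsupp.support (show WeylD →₀ R from ξ)

theorem mem_support {ξ : NilCoxeter R} {w : WeylD} : w ∈ ξ.support ↔ ξ.coeff w ≠ 0 :=
  Finsupp.mem_support_iff

theorem eq_sum_single (ξ : NilCoxeter R) : ξ = ∑ w ∈ ξ.support, single w (ξ.coeff w) :=
  (Finsupp.sum_single (show WeylD →₀ R from ξ)).symm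

open Classical in
/-- The projection onto the span of the `u_w` with `w` in a parabolic subgroup. -/
def proj {H : Subgroup WeylD} (hH : IsParabolic H) : NilCoxeter R →+* NilCoxeter R where
  toFun ξ := Finsupp.filter (· ∈ H) (show WeylD →₀ R from ξ)
  map_zero' := Finsupp.filter_zero _
  map_add' _ _ := Finsupp.filter_add
  map_one' := Finsupp.filter_single_of_pos _ H.one_mem
  map_mul' ξ η := by
    let F : (WeylD →₀ R) →+ (WeylD →₀ R) := Finsupp.filterAddHom (· ∈ H)
    have hF : ∀ (x : WeylD) (c : R), F (Finsupp.single x c) =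
        if x ∈ H then Finsupp.single x c else 0 := fun x c => by
      split_ifs with hx
      · exact Finsupp.filter_single_of_pos _ hx
      · exact Finsupp.filter_single_of_neg _ hx
    change F (nilMul ξ η) = nilMul (F ξ) (F η)
    induction ξ using induction_linear with
    | zero =>
      exact (congrArg F (nilMul_zero_left _)).trans
        ((map_zero F).trans ((congrArg (nilMul · _) (map_zero F)).trans (nilMul_zero_left _)).symm)
    | add ξ ξ' h h' =>
      refine (congrArg F (nilMul_add_left ξ ξ' η)).trans ((F.map_add _ _).trans ?_)
      rw [h, h', ← nilMul_add_left]
      exact congrArg (nilMul · _) (F.map_add _ _).symm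
    | single v a =>
      induction η using induction_linear with
      | zero =>
        exact (congrArg F (nilMul_zero_right _)).trans
          ((map_zero F).trans ((congrArg (nilMul _) (map_zero F)).trans (nilMul_zero_right _)).symm)
      | add η η' h h' =>
        refine (congrArg F (nilMul_add_right _ η η')).trans ((F.map_add _ _).trans ?_)
        rw [h, h', ← nilMul_add_right]
        exact congrArg (nilMul _) (F.map_add _ _).symm
      | single w b =>
        unfold single
        rw [hF, hF, nilMul_single_single]
        -- Multiplicativity holds because, when lengths add, `v * w ∈ H` exactly if both factors are
        -- in `H`.
        by_cases hl : length (v * w) = length v + length w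
        · rw [if_pos hl, hF]
          by_cases hvw : v * w ∈ H
          · rw [if_pos hvw, if_pos (hH.left_mem hl hvw), if_pos (hH.right_mem hl hvw),
              nilMul_single_single, if_pos hl]
          · rw [if_neg hvw]
            split_ifs with h1 h2
            · exact absurd (H.mul_mem h1 h2) hvw
            · exact (nilMul_zero_right _).symm
            · exact (nilMul_zero_left _).symm
            · exact (nilMul_zero_left _).symm
        · rw [if_neg hl, map_zero]
          split_ifs
          · rw [nilMul_single_single, if_neg hl]
          · exact (nilMul_zero_right _).symm
          · exact (nilMul_zero_left _).symm
          · exact (nilMul_zero_left _).symm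

open Classical in
theorem coeff_proj {H : Subgroup WeylD} (hH : IsParabolic H) (ξ : NilCoxeter R) (w : WeylD) :
    (proj hH ξ).coeff w = if w ∈ H then ξ.coeff w else 0 :=
  Finsupp.filter_apply (· ∈ H) (show WeylD →₀ R from ξ) w

open Classical in
theorem proj_single {H : Subgroup WeylD} (hH : IsParabolic H) (w : WeylD) (a : R) :
    proj hH (single w a) = if w ∈ H then single w a else 0 := by
  ext v
  rw [coeff_proj, coeff_single]
  by_cases hv : w = v
  · subst hv
    by_cases hw : w ∈ H <;> simp [hw, coeff_single]
  · rw [if_neg hv, ite_self]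
    split_ifs
    · rw [coeff_single, if_neg hv]
    · rfl

/-- The anti-automorphism `u_w ↦ u_{w⁻¹}`. -/
def invHom : NilCoxeter R →+* (NilCoxeter R)ᵐᵒᵖ where
  toFun ξ := MulOpposite.op (Finsupp.equivMapDomain (Equiv.inv WeylD) (show WeylD →₀ R from ξ))
  map_zero' := by
    apply MulOpposite.unop_injective
    exact Finsupp.equivMapDomain_zero
  map_add' ξ η := by
    apply MulOpposite.unop_injective
    exact (Finsupp.domCongr (M := R) (Equiv.inv WeylD)).map_add ξ η
  map_one' := by
    apply MulOpposite.unop_injective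
    refine (Finsupp.equivMapDomain_single _ _ _).trans ?_
    change Finsupp.single (1⁻¹ : WeylD) (1 : R) = Finsupp.single 1 1
    rw [inv_one]
  map_mul' ξ η := by
    apply MulOpposite.unop_injective
    let F : (WeylD →₀ R) →+ (WeylD →₀ R) :=
      (Finsupp.domCongr (M := R) (Equiv.inv WeylD)).toAddMonoidHom
    have hF : ∀ (w : WeylD) (a : R), F (Finsupp.single w a) = Finsupp.single w⁻¹ a :=
      fun w a => Finsupp.equivMapDomain_single _ _ _
    change F (nilMul ξ η) = nilMul (F η) (F ξ)
    induction ξ using induction_linear with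
    | zero => exact (congrArg F (nilMul_zero_left _)).trans (nilMul_zero_right _).symm
    | add ξ ξ' h h' =>
      refine (congrArg F (nilMul_add_left ξ ξ' η)).trans ((F.map_add _ _).trans ?_)
      rw [h, h', ← nilMul_add_right]
      exact congrArg (nilMul _) (F.map_add _ _).symm
    | single v a =>
      induction η using induction_linear with
      | zero => exact (congrArg F (nilMul_zero_right _)).trans (nilMul_zero_left _).symm
      | add η η' h h' =>
        refine (congrArg F (nilMul_add_right _ η η')).trans ((F.map_add _ _).trans ?_)
        rw [h, h', ← nilMul_add_left]
        exact congrArg (nilMul · _) (F.map_add _ _).symm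
      | single w b =>
        unfold single
        rw [hF, hF, nilMul_single_single, nilMul_single_single, ← mul_inv_rev, length_inv,
          length_inv, length_inv, add_comm (length w), mul_comm b a]
        split_ifs
        · exact hF _ _
        · exact F.map_zero

theorem coeff_invHom (ξ : NilCoxeter R) (w : WeylD) :
    (invHom ξ).unop.coeff w = ξ.coeff w⁻¹ :=
  Finsupp.equivMapDomain_apply (Equiv.inv WeylD) (show WeylD →₀ R from ξ) w

theorem invHom_single (w : WeylD) (a : R) :
    invHom (single w a) = MulOpposite.op (single w⁻¹ a) :=
  congrArg MulOpposite.op (Finsupp.equivMapDomain_single (Equiv.inv WeylD) w a)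

/-- The embedding of the coefficient ring. -/
def scalar : R →+* NilCoxeter R where
  toFun := single 1
  map_zero' := single_zero 1
  map_one' := rfl
  map_add' := single_add 1
  map_mul' a b := by rw [single_mul_single, if_pos (by simp [length_one]), mul_one]

theorem scalar_mul_single (a : R) (w : WeylD) (b : R) :
    scalar a * single w b = single w (a * b) := by
  change single 1 a * _ = _
  rw [single_mul_single, if_pos (by simp [length_one]), one_mul]

theorem single_mul_scalar (a : R) (w : WeylD) (b : R) :
    single w b * scalar a = single w (a * b) := by
  change _ * single 1 a = _
  rw [single_mul_single, if_pos (by simp [length_one]), mul_one, mul_comm]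

theorem scalar_commute (a : R) (ξ : NilCoxeter R) : scalar a * ξ = ξ * scalar a := by
  induction ξ using induction_linear with
  | zero => simp
  | add ξ η h h' => rw [mul_add, add_mul, h, h']
  | single w b => rw [scalar_mul_single, single_mul_scalar]

/-- Allows `1 + t u_i` to be written with a scalar action, so that the Yang–Baxter equation can be
checked in an abstract algebra. -/
instance : Algebra R (NilCoxeter R) := scalar.toAlgebra' scalar_commute

theorem single_eq_smul (w : WeylD) (a : R) : single w a = a • single w (1 : R) := by
  rw [Algebra.smul_def]
  exact ((scalar_mul_single a w 1).trans (by rw [mul_one])).symm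

open Classical in
/-- The product of the `c_k u_{w_k}` is a multiple of `u_w` if `w_1 ⋯ w_m = w` is reduced, and `0`
if the factorization is not reduced. -/
theorem prod_ofFn_single {m : ℕ} (u : Fin m → WeylD) (c : Fin m → R) :
    (List.ofFn fun k => single (u k) (c k)).prod =
      if length (List.ofFn u).prod = ∑ k, length (u k) then
        single (List.ofFn u).prod (∏ k, c k) else 0 := by
  induction m with
  | zero => simp [length_one, one_def]
  | succ m ih =>
    have h1 := length_prod_ofFn_le fun k => u k.succ
    have h2 := length_mul_le (u 0) (List.ofFn fun k => u k.succ).prod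
    rw [List.ofFn_succ, List.prod_cons, ih, List.ofFn_succ, List.prod_cons, Fin.sum_univ_succ,
      Fin.prod_univ_succ]
    by_cases h : length (List.ofFn fun k => u k.succ).prod = ∑ k, length (u (Fin.succ k))
    · rw [if_pos h, single_mul_single, h]
    · rw [if_neg h, mul_zero, if_neg (by omega)]

/-- The coefficient of a product as a sum over reduced factorizations. -/
theorem coeff_prod_ofFn {m : ℕ} (ξ : Fin m → NilCoxeter R) (w : WeylD) :
    (List.ofFn ξ).prod.coeff w =
      ∑ᶠ u ∈ {u : Fin m → WeylD | IsReducedFactorization u w}, ∏ k, (ξ k).coeff (u k) := by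
  classical
  have h0 : (List.ofFn ξ).prod = ∑ u ∈ Fintype.piFinset fun k => (ξ k).support,
      (List.ofFn fun k => single (u k) ((ξ k).coeff (u k))).prod := by
    -- Ordered multiplication is multilinear, so the product expands over all choices of one basis
    -- term per factor.
    have := (MultilinearMap.mkPiAlgebraFin ℤ m (NilCoxeter R)).map_sum_finset
      (fun k v => single v ((ξ k).coeff v)) fun k => (ξ k).support
    simp only [MultilinearMap.mkPiAlgebraFin_apply, ← eq_sum_single] at this
    exact this
  rw [h0, coeff_sum, finsum_mem_def]
  rw [finsum_eq_sum_of_support_subset (s := Fintype.piFinset fun k => (ξ k).support)]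
  · refine Finset.sum_congr rfl fun u _ => ?_
    rw [prod_ofFn_single, Set.indicator_apply]
    by_cases h2 : IsReducedFactorization u w
    · rw [if_pos (by rw [h2.1, h2.2]), if_pos (show u ∈ {u | IsReducedFactorization u w} from h2),
        coeff_single, if_pos h2.1]
    · rw [if_neg (show u ∉ {u | IsReducedFactorization u w} from h2)]
      split_ifs with h1
      · rw [coeff_single, if_neg]
        rintro rfl
        exact h2 ⟨rfl, h1.symm⟩
      · rfl
  · intro u hu
    rw [Function.mem_support, Set.indicator_apply] at hu
    rw [Finset.mem_coe, Fintype.mem_piFinset]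
    intro k
    rw [mem_support]
    intro h
    apply hu
    rw [Finset.prod_eq_zero (Finset.mem_univ k) h, ite_self]

/-- The elements with coefficients in a subring of the coefficient ring. -/
def coeffSubring (S : Subring R) : Subring (NilCoxeter R) where
  carrier := {ξ | ∀ w, ξ.coeff w ∈ S}
  zero_mem' _ := S.zero_mem
  one_mem' w := by
    classical
    rw [one_def, coeff_single]
    split_ifs
    exacts [S.one_mem, S.zero_mem]
  add_mem' h h' w := S.add_mem (h w) (h' w)
  neg_mem' h w := S.neg_mem (h w)
  mul_mem' {ξ η} h h' w := by
    classical
    rw [eq_sum_single ξ, eq_sum_single η, Finset.sum_mul_sum, coeff_sum]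
    refine S.sum_mem fun v _ => ?_
    rw [coeff_sum]
    refine S.sum_mem fun v' _ => ?_
    rw [single_mul_single]
    split_ifs
    · rw [coeff_single]
      split_ifs
      exacts [S.mul_mem (h v) (h' v'), S.zero_mem]
    · exact S.zero_mem

theorem single_mem_coeffSubring {S : Subring R} {w : WeylD} {a : R} (ha : a ∈ S) :
    single w a ∈ coeffSubring S := by
  classical
  intro v
  rw [coeff_single]
  split_ifs
  exacts [ha, S.zero_mem]

/-- A nonzero `u_v u_r` equals `u_{v s_r}` with lengths adding, and `v s_r` has a descent at `r`. -/
theorem coeff_mul_single_simple {w : WeylD} {r : ℕ} (h : ¬ IsDescent w r) (ξ : NilCoxeter R)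
    (t : R) : (ξ * single (simple r) t).coeff w = 0 := by
  classical
  induction ξ using induction_linear with
  | zero => simp
  | add ξ η h h' => rw [add_mul, coeff_add, h, h', add_zero]
  | single v a =>
    rw [single_mul_single]
    split_ifs with hl
    · rw [coeff_single, if_neg]
      rintro rfl
      apply h
      have h1 := length_mul_le (v * simple r) (simple r)
      have h2 := length_simple_le r
      have h3 : v * simple r * simple r = v := by rw [mul_assoc, simple_mul_self, mul_one]
      have h4 : length (simple r) ≠ 0 := by
        intro h0
        obtain ⟨m, hm, hm'⟩ := exists_reduced_word (simple r)
        rw [h0, List.length_eq_zero_iff] at hm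
        subst hm
        have h5 : lo r = simplePerm r (lo r) := congrArg (fun v : WeylD => v.1 (lo r)) hm'
        rw [simplePerm_lo] at h5
        exact (lo_lt_hi r).ne h5
      unfold IsDescent
      rw [h3]
      omega
    · rfl

end NilCoxeter

/-! ### Relations -/

/-- The Yang–Baxter equation. -/
theorem yang_baxter {R A : Type*} [CommRing R] [Ring A] [Algebra R A] {u v : A} (hu : u * u = 0)
    (hv : v * v = 0) (h : u * v * u = v * u * v) (x y : R) :
    (1 + x • u) * (1 + (x + y) • v) * (1 + y • u) =
      (1 + y • v) * (1 + (x + y) • u) * (1 + x • v) := by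
  simp only [mul_add, add_mul, one_mul, mul_one, smul_mul_assoc, mul_smul_comm, hu, hv, h,
    smul_zero]
  module

theorem one_add_smul_mul {R A : Type*} [CommRing R] [Ring A] [Algebra R A] {u : A}
    (hu : u * u = 0) (x y : R) : (1 + x • u) * (1 + y • u) = 1 + (x + y) • u := by
  simp only [mul_add, add_mul, one_mul, mul_one, smul_mul_assoc, mul_smul_comm, hu, smul_zero]
  module

namespace NilCoxeter

variable {R : Type} [CommRing R]

theorem single_simple_mul_self (i : ℕ) :
    single (simple i) (1 : R) * single (simple i) 1 = 0 := by
  have h := prod_single_simple (R := R) [i, i]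
  have h1 : wordProd [i, i] = 1 := by simp [wordProd, simple_mul_self]
  rw [h1, length_one] at h
  simpa using h

theorem prod_single_simple_congr {l l' : List ℕ} (h : wordProd l = wordProd l')
    (hl : l.length = l'.length) :
    (l.map fun i => single (simple i) (1 : R)).prod =
      (l'.map fun i => single (simple i) (1 : R)).prod := by
  rw [prod_single_simple, prod_single_simple, h, hl]

end NilCoxeter

theorem simple_mul_comm {i j : ℕ} (h1 : 1 ≤ i) (hij : i + 2 ≤ j) :
    simple i * simple j = simple j * simple i := by
  obtain ⟨i, rfl⟩ : ∃ k, i = k + 1 := ⟨i - 1, by omega⟩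
  obtain ⟨j, rfl⟩ : ∃ k, j = k + 1 := ⟨j - 1, by omega⟩
  apply simple_mul_eq_mul_simple
  left
  change simplePerm (j + 1) _ = _ ∧ simplePerm (j + 1) _ = _
  constructor <;> simp only [lo, hi, simplePerm_succ_apply] <;> split_ifs <;> omega

/-- The element `s_{i+1} s_i` carries the pair `(i+1, i+2)` to `(i, i+1)`, hence conjugates
`s_{i+1}` into `s_i`. -/
theorem simple_braid {i : ℕ} (h1 : 1 ≤ i) :
    simple i * simple (i + 1) * simple i = simple (i + 1) * simple i * simple (i + 1) := by
  obtain ⟨i, rfl⟩ : ∃ k, i = k + 1 := ⟨i - 1, by omega⟩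
  have h : simple (i + 1) * (simple (i + 1 + 1) * simple (i + 1)) =
      (simple (i + 1 + 1) * simple (i + 1)) * simple (i + 1 + 1) := by
    apply simple_mul_eq_mul_simple
    left
    change simplePerm (i + 1 + 1) (simplePerm (i + 1) _) = _ ∧
      simplePerm (i + 1 + 1) (simplePerm (i + 1) _) = _
    constructor
    · have e : simplePerm (i + 1) (lo (i + 1 + 1)) = i + 1 := by
        simp only [lo, simplePerm_succ_apply]
        push_cast
        split_ifs <;> omega
      rw [e, simplePerm_succ_apply]
      simp only [lo]
      push_cast
      split_ifs <;> omega
    · have e : simplePerm (i + 1) (hi (i + 1 + 1)) = i + 3 := by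
        simp only [hi, simplePerm_succ_apply]
        push_cast
        split_ifs <;> omega
      rw [e, simplePerm_succ_apply]
      simp only [hi]
      push_cast
      split_ifs <;> omega
  rw [mul_assoc, h]

open NilCoxeter

theorem factor_eq (i : ℕ) (t : Series) :
    factor i t = 1 + t • single (simple i) (1 : Series) := by
  rw [factor, ← single_eq_smul]

theorem factor_mul_factor (i : ℕ) (s t : Series) : factor i s * factor i t = factor i (s + t) := by
  simp only [factor_eq]
  exact one_add_smul_mul (single_simple_mul_self i) s t

theorem factor_zero (i : ℕ) : factor i 0 = 1 := by
  rw [factor_eq, zero_smul, add_zero]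

theorem factor_commute {i j : ℕ} (hi : 1 ≤ i) (hij : i + 2 ≤ j) (s t : Series) :
    Commute (factor j s) (factor i t) := by
  have h := prod_single_simple_congr (R := Series) (l := [j, i]) (l' := [i, j])
    (by simp [wordProd, simple_mul_comm hi hij]) rfl
  simp only [List.map_cons, List.map_nil, List.prod_cons, List.prod_nil, mul_one] at h
  have h' : Commute (single (simple j) (1 : Series)) (single (simple i) (1 : Series)) := h
  rw [factor_eq, factor_eq]
  exact (Commute.one_left _).add_left
    (((Commute.one_right _).add_right (h'.smul_right t)).smul_left s)

theorem factor_yang_baxter {i : ℕ} (hi : 1 ≤ i) (x y : Series) :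
    factor i x * factor (i + 1) (x + y) * factor i y =
      factor (i + 1) y * factor i (x + y) * factor (i + 1) x := by
  simp only [factor_eq]
  refine yang_baxter (single_simple_mul_self i) (single_simple_mul_self (i + 1)) ?_ x y
  have h := prod_single_simple_congr (R := Series) (l := [i, i + 1, i]) (l' := [i + 1, i, i + 1])
    (by simpa [wordProd, mul_assoc] using simple_braid hi) rfl
  simpa [mul_assoc] using h

/-! ### The operators `A_i` -/

theorem opA_of_le {n i : ℕ} (h : n ≤ i) (t : Series) : opA n i t = 1 := by
  simp [opA, Nat.sub_eq_zero_of_le h]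

theorem opA_eq_mul {n i : ℕ} (h : i < n) (t : Series) :
    opA n i t = opA n (i + 1) t * factor i t := by
  obtain ⟨d, hd⟩ : ∃ d, n - i = d + 1 := ⟨n - i - 1, by omega⟩
  have hd' : n - (i + 1) = d := by omega
  simp [opA, hd, hd', List.range'_succ]

theorem commute_list_factor {l : List ℕ} {r : ℕ} (hr : 1 ≤ r) (h : ∀ j ∈ l, r + 2 ≤ j)
    (s t : Series) : Commute (l.map fun j => factor j t).prod (factor r s) := by
  refine Commute.list_prod_left _ _ fun x hx => ?_
  obtain ⟨j, hj, rfl⟩ := List.mem_map.1 hx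
  exact factor_commute hr (h j hj) t s

theorem opA_commute_factor {n i r : ℕ} (hr : 1 ≤ r) (h : r + 2 ≤ i) (s t : Series) :
    Commute (opA n i t) (factor r s) := by
  refine commute_list_factor hr (fun j hj => ?_) s t
  rw [List.mem_reverse, List.mem_range'_1] at hj
  omega

/-- Downward induction on `i`, with `d` bounding `n - i`. Splitting `1 + t u_i` as `(1 + (t-s)
u_i)(1 + s u_i)` produces a triple to which Yang–Baxter applies. Then `A_{i+1}(s)` and `A_{i+1}(t)`
are exchanged by induction, and `A_{i+2}` moves freely past `u_i`. -/
theorem opA_commute_aux (n d : ℕ) : ∀ i, 1 ≤ i → n ≤ i + d →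
    ∀ s t : Series, opA n i s * opA n i t = opA n i t * opA n i s := by
  induction d with
  | zero => intro i _ hn s t; rw [opA_of_le (by omega), opA_of_le (by omega)]
  | succ d ih =>
    intro i hi hn s t
    rcases le_or_gt n i with h | h
    · rw [opA_of_le h, opA_of_le h]
    rw [opA_eq_mul h, opA_eq_mul h]
    rcases le_or_gt n (i + 1) with h' | h'
    · rw [opA_of_le h', opA_of_le h', one_mul, one_mul, factor_mul_factor, factor_mul_factor,
        add_comm]
    have hs := fun t => opA_eq_mul h' t
    have c := fun s t => (opA_commute_factor (n := n) hi (le_refl (i + 2)) s t).eq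
    have e1 : factor i t = factor i (t - s) * factor i s := by rw [factor_mul_factor, sub_add_cancel]
    have yb : factor i s * factor (i + 1) t * factor i (t - s) =
        factor (i + 1) (t - s) * factor i t * factor (i + 1) s := by
      have := factor_yang_baxter hi s (t - s)
      rwa [add_sub_cancel] at this
    have e2 : factor (i + 1) (t - s) = factor (i + 1) t * factor (i + 1) (-s) := by
      rw [factor_mul_factor, sub_eq_add_neg]
    have e3 : opA n (i + 2) s = opA n (i + 1) s * factor (i + 1) (-s) := by
      rw [hs, mul_assoc, factor_mul_factor, add_neg_cancel, factor_zero, mul_one]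
    calc opA n (i + 1) s * factor i s * (opA n (i + 1) t * factor i t)
        = opA n (i + 1) s * (factor i s * opA n (i + 2) t) * factor (i + 1) t * factor i t := by
          rw [hs t]; simp only [mul_assoc]
      _ = opA n (i + 1) s * opA n (i + 2) t *
            (factor i s * factor (i + 1) t * factor i (t - s)) * factor i s := by
          rw [← c, e1]; simp only [mul_assoc]
      _ = opA n (i + 1) s * (opA n (i + 2) t * factor (i + 1) t) * factor (i + 1) (-s) *
            factor i t * factor (i + 1) s * factor i s := by
          rw [yb, e2]; simp only [mul_assoc]
      _ = opA n (i + 1) t * (opA n (i + 1) s * factor (i + 1) (-s)) *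
            factor i t * factor (i + 1) s * factor i s := by
          rw [← hs t, ih (i + 1) (by omega) (by omega) s t]; simp only [mul_assoc]
      _ = opA n (i + 1) t * (opA n (i + 2) s * factor i t) * factor (i + 1) s * factor i s := by
          rw [← e3]; simp only [mul_assoc]
      _ = opA n (i + 1) t * factor i t * (opA n (i + 1) s * factor i s) := by
          rw [c, hs s]; simp only [mul_assoc]

theorem opA_commute {n i : ℕ} (hi : 1 ≤ i) (s t : Series) : Commute (opA n i s) (opA n i t) :=
  opA_commute_aux n n i hi (by omega) s t

/-! ### Effect of inversion and of parabolic projections on the operators -/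

theorem invHom_factor (i : ℕ) (t : Series) : invHom (factor i t) = MulOpposite.op (factor i t) := by
  have hs : (simple i)⁻¹ = simple i := inv_eq_of_mul_eq_one_left (simple_mul_self i)
  rw [factor, map_add, map_one, invHom_single, hs]
  rfl

theorem unop_invHom_list_prod {R : Type} [CommRing R] (l : List (NilCoxeter R)) :
    (invHom l.prod).unop = (l.reverse.map fun ξ => (invHom ξ).unop).prod := by
  rw [map_list_prod, MulOpposite.unop_list_prod, List.map_map, List.map_reverse]
  rfl

theorem unop_invHom_opA' (n i : ℕ) (t : Series) : (invHom (opA' n i t)).unop = opA n i (-t) := by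
  rw [opA', unop_invHom_list_prod, opA, List.map_reverse, List.map_reverse, List.map_map]
  simp only [Function.comp_def, invHom_factor, MulOpposite.unop_op]

-- The projection is multiplicative and sends `1 + t u_j` to `1` when `s_j ∉ H`, so it merely
-- deletes factors.
open Classical in
theorem proj_list_factor {H : Subgroup WeylD} (hH : IsParabolic H) (l : List ℕ) (t : Series) :
    proj hH (l.map fun j => factor j t).prod =
      ((l.filter fun j => simple j ∈ H).map fun j => factor j t).prod := by
  induction l with
  | nil => exact map_one _
  | cons i l ih =>
    rw [List.map_cons, List.prod_cons, map_mul, ih, factor, map_add, map_one, proj_single,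
      List.filter_cons]
    by_cases h : simple i ∈ H
    · rw [if_pos h, if_pos (decide_eq_true h)]
      rfl
    · rw [if_neg h, if_neg (by simpa using h), add_zero, one_mul]

open Classical in
theorem filter_range'_eq {H : Subgroup WeylD} {i k i' k' : ℕ}
    (h : ∀ j, (i ≤ j ∧ j < i + k) ∧ simple j ∈ H ↔ i' ≤ j ∧ j < i' + k') :
    (List.range' i k).filter (fun j => simple j ∈ H) = List.range' i' k' := by
  refine List.Pairwise.eq_of_mem_iff (r := (· < ·)) ?_ (List.pairwise_lt_range' ..) fun j => ?_
  · exact List.Pairwise.filter _ (List.pairwise_lt_range' ..)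
  · simpa [List.mem_filter, List.mem_range'_1] using h j

theorem proj_permSubgroup_opA (n c : ℕ) (t : Series) :
    proj (isParabolic_permSubgroup c) (opA n 1 t) = opA n (c + 1) t := by
  rw [opA, proj_list_factor, List.filter_reverse, filter_range'_eq (i' := c + 1)
    (k' := n - (c + 1)) fun j => by rw [simple_mem_permSubgroup]; omega]
  rfl

theorem proj_permSubgroup_opA' (n c : ℕ) (t : Series) :
    proj (isParabolic_permSubgroup c) (opA' n 1 t) = opA' n (c + 1) t := by
  rw [opA', proj_list_factor, filter_range'_eq (i' := c + 1)
    (k' := n - (c + 1)) fun j => by rw [simple_mem_permSubgroup]; omega]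
  rfl

theorem proj_weylSubgroup_opA {m n : ℕ} (hm : 2 ≤ m) (hmn : m ≤ n) (i : ℕ) (t : Series) :
    proj (isParabolic_weylSubgroup hm) (opA n i t) = opA m i t := by
  rw [opA, proj_list_factor, List.filter_reverse, filter_range'_eq (i' := i)
    (k' := m - i) fun j => by rw [simple_mem_weylSubgroup hm]; omega]
  rfl

theorem proj_weylSubgroup_opA' {m n : ℕ} (hm : 2 ≤ m) (hmn : m ≤ n) (i : ℕ) (t : Series) :
    proj (isParabolic_weylSubgroup hm) (opA' n i t) = opA' m i t := by
  rw [opA', proj_list_factor, filter_range'_eq (i' := i)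
    (k' := m - i) fun j => by rw [simple_mem_weylSubgroup hm]; omega]
  rfl

theorem proj_weylSubgroup_opD {m n : ℕ} (hm : 2 ≤ m) (hmn : m ≤ n) (t : Series) :
    proj (isParabolic_weylSubgroup hm) (opD n t) = opD m t := by
  rw [opD, map_mul, map_mul, proj_weylSubgroup_opA hm hmn, proj_list_factor,
    filter_range'_eq (i' := 2) (k' := m - 2) fun j => by rw [simple_mem_weylSubgroup hm]; omega,
    factor, map_add, map_one, proj_single, if_pos ((simple_mem_weylSubgroup hm).2 (by omega))]
  rfl

theorem proj_weylSubgroup_prodD {m n : ℕ} (hm : 2 ≤ m) (hmn : m ≤ n) (N : ℕ) :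
    proj (isParabolic_weylSubgroup hm) (prodD n N) = prodD m N := by
  rw [prodD, map_list_prod, List.map_map]
  simp only [Function.comp_def, proj_weylSubgroup_opD hm hmn]
  rfl

/-! ### Removing letters which are not descents -/

theorem coeff_mul_factor {w : WeylD} {r : ℕ} (h : ¬ IsDescent w r) (ξ : NilCoxeter Series)
    (t : Series) : (ξ * factor r t).coeff w = ξ.coeff w := by
  rw [factor, mul_add, mul_one, coeff_add, coeff_mul_single_simple h, add_zero]

/-- `A_c(t)` is `A_j(t)` followed by factors with letters `j-1, …, c`. Each of them moves through
`T` to the far right and is absorbed there. -/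
theorem coeff_mul_opA_mul {n c j : ℕ} (hcj : c ≤ j) {w : WeylD} {T : NilCoxeter Series}
    (hw : ∀ r, c ≤ r → r < j → ¬ IsDescent w r)
    (hT : ∀ r, c ≤ r → r < j → ∀ s, Commute T (factor r s)) (ξ : NilCoxeter Series) (t : Series) :
    (ξ * opA n c t * T).coeff w = (ξ * opA n j t * T).coeff w := by
  obtain ⟨d, rfl⟩ := Nat.exists_eq_add_of_le hcj
  clear hcj
  induction d with
  | zero => rfl
  | succ d ih =>
    rw [ih (fun r h1 h2 => hw r h1 (by omega)) fun r h1 h2 => hT r h1 (by omega)]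
    rcases le_or_gt n (c + d) with h | h
    · rw [opA_of_le h, opA_of_le (by omega)]
    · rw [opA_eq_mul h, ← mul_assoc, mul_assoc _ (factor _ _), ← (hT _ (by omega) (by omega) t).eq,
        ← mul_assoc, coeff_mul_factor (hw _ (by omega) (by omega))]
      rfl

/-- The product `A_{k+1}(y_{k+1}) ⋯ A_{n-1}(y_{n-1})`. -/
def tailA (n : ℕ) (y : ℕ → Series) (k : ℕ) : NilCoxeter Series :=
  ((List.range' (k + 1) (n - 1 - k)).map fun i => opA n i (y i)).prod

theorem tailA_eq_mul (n : ℕ) (y : ℕ → Series) (k : ℕ) :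
    tailA n y k = opA n (k + 1) (y (k + 1)) * tailA n y (k + 1) := by
  rcases Nat.lt_or_ge k (n - 1) with h | h
  · obtain ⟨d, hd⟩ : ∃ d, n - 1 - k = d + 1 := ⟨n - 1 - k - 1, by omega⟩
    have hd' : n - 1 - (k + 1) = d := by omega
    simp [tailA, hd, hd', List.range'_succ]
  -- Past `n - 1` all operators are `1`. Hence the sequences `a`, `b` may exceed the rank of `w`.
  · rw [opA_of_le (by omega)]
    simp [tailA, Nat.sub_eq_zero_of_le h, Nat.sub_eq_zero_of_le (h.trans (Nat.le_succ k))]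

theorem tailA_commute_factor {n k r : ℕ} (hr : 1 ≤ r) (h : r < k) (y : ℕ → Series) (s : Series) :
    Commute (tailA n y k) (factor r s) := by
  refine Commute.list_prod_left _ _ fun x hx => ?_
  obtain ⟨j, hj, rfl⟩ := List.mem_map.1 hx
  rw [List.mem_range'_1] at hj
  exact opA_commute_factor hr (by omega) _ _

/-- All letters of the tail exceed `k`, so its factors are absorbed one by one from the right. -/
theorem coeff_mul_tailA {n k : ℕ} {w : WeylD} (hw : ∀ r, k < r → ¬ IsDescent w r)
    (ξ : NilCoxeter Series) (y : ℕ → Series) : (ξ * tailA n y k).coeff w = ξ.coeff w := by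
  have h1 : ∀ (l : List ℕ), (∀ j ∈ l, k < j) → ∀ (ξ : NilCoxeter Series) (t : Series),
      (ξ * (l.map fun j => factor j t).prod).coeff w = ξ.coeff w := by
    intro l
    induction l with
    | nil => intros; simp
    | cons i l ih =>
      intro hl ξ t
      rw [List.map_cons, List.prod_cons, ← mul_assoc, ih fun j hj => hl j (by simp [hj]),
        coeff_mul_factor (hw i (hl i (by simp)))]
  have h2 : ∀ (l : List ℕ), (∀ j ∈ l, k < j) → ∀ ξ : NilCoxeter Series,
      (ξ * (l.map fun j => opA n j (y j)).prod).coeff w = ξ.coeff w := by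
    intro l
    induction l with
    | nil => intros; simp
    | cons i l ih =>
      intro hl ξ
      rw [List.map_cons, List.prod_cons, ← mul_assoc, ih fun j hj => hl j (by simp [hj])]
      refine h1 _ (fun j hj => ?_) ξ _
      have := hl i (by simp)
      rw [List.mem_reverse, List.mem_range'_1] at hj
      omega
  refine h2 _ (fun j hj => ?_) ξ
  rw [List.mem_range'_1] at hj
  omega

/-- Operators are enlarged from left to right. Those already enlarged are put into `ξ`, while the
remaining tail has only letters at least `2` above the extra letters, so these commute with it. -/
theorem coeff_mul_tailA_block {n c : ℕ} (hc : 1 ≤ c) {w : WeylD} (y : ℕ → Series) (L : ℕ) :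
    ∀ k, c ≤ k + 1 → (∀ r, c ≤ r → r < k + L → ¬ IsDescent w r) → ∀ ξ : NilCoxeter Series,
      (ξ * tailA n y k).coeff w =
        (ξ * ((List.range' (k + 1) L).map fun i => opA n c (y i)).prod *
          tailA n y (k + L)).coeff w := by
  induction L with
  | zero => intro k _ _ ξ; simp
  | succ L ih =>
    intro k hk hw ξ
    rw [tailA_eq_mul, ← mul_assoc, ← coeff_mul_opA_mul hk (fun r h1 h2 => hw r h1 (by omega))
      fun r h1 h2 s => tailA_commute_factor (by omega) h2 y s,
      ih (k + 1) (by omega) (fun r h1 h2 => hw r h1 (by omega)), List.range'_succ, List.map_cons,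
      List.prod_cons, ← mul_assoc, show k + 1 + L = k + (L + 1) by omega]

/-! ### Regrouping the operators by alphabets -/

/-- The number of variables in the blocks before the `i`-th. -/
def blockStart (a : ℕ → ℕ) (i : ℕ) : ℕ := if i ≤ 1 then 0 else a (i - 1)

/-- The product `∏ A_c(y_j)` over the `i`-th block of variables, where `c` is the least index in
the block. -/
def blockA (n : ℕ) (y : ℕ → Series) (a : ℕ → ℕ) (i : ℕ) : NilCoxeter Series :=
  ((block a i).map fun j => opA n (blockStart a i + 1) (y j)).prod

/-- The product `∏ Ã_c(z_j)` over the `i`-th block of variables, where `c` is the least index in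
the block. -/
def blockA' (n : ℕ) (z : ℕ → Series) (a : ℕ → ℕ) (i : ℕ) : NilCoxeter Series :=
  ((block a i).map fun j => opA' n (blockStart a i + 1) (z j)).prod

theorem blockStart_le {p : ℕ} {a : ℕ → ℕ} (ha : StrictMonoOn a (Set.Icc 1 p)) {i : ℕ}
    (hip : i ≤ p) : blockStart a i ≤ a i := by
  unfold blockStart
  split_ifs with h
  · exact Nat.zero_le _
  · exact (ha (Set.mem_Icc.2 (by omega)) (Set.mem_Icc.2 (by omega)) (by omega)).le

/-- Strictness at the lower end matters for `i = 1`: nothing is said about `□`, which occurs in no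
`A_i`. -/
theorem not_isDescent_of_lt {p : ℕ} {a : ℕ → ℕ} (ha : StrictMonoOn a (Set.Icc 1 p)) {w : WeylD}
    (hw : IsCompatible w p a) {i : ℕ} (hi : 1 ≤ i) (hip : i ≤ p) {r : ℕ} (h1 : blockStart a i < r)
    (h2 : r < a i) : ¬ IsDescent w r := by
  intro h
  obtain ⟨j, hj1, hj2, rfl⟩ := hw r h
  rcases Nat.lt_or_ge j i with hji | hji
  · rw [blockStart, if_neg (by omega)] at h1
    have := ha.monotoneOn (Set.mem_Icc.2 ⟨hj1, hj2⟩) (Set.mem_Icc.2 ⟨by omega, by omega⟩)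
      (show j ≤ i - 1 by omega)
    omega
  · have := ha.monotoneOn (Set.mem_Icc.2 ⟨hi, hip⟩) (Set.mem_Icc.2 ⟨hj1, hj2⟩) hji
    omega

theorem coeff_mul_tailA_eq {n p : ℕ} (hp : 1 ≤ p) {a : ℕ → ℕ} (ha : StrictMonoOn a (Set.Icc 1 p))
    {w : WeylD} (hw : IsCompatible w p a) (y : ℕ → Series) (ξ : NilCoxeter Series) :
    (ξ * tailA n y 0).coeff w = (ξ * ((List.range' 1 p).map (blockA n y a)).prod).coeff w := by
  -- The state after the first `P` alphabets are regrouped. For `P = p` the remaining tail lies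
  -- beyond every descent.
  have key : ∀ P ≤ p, (ξ * tailA n y 0).coeff w =
      (ξ * ((List.range' 1 P).map (blockA n y a)).prod *
        tailA n y (blockStart a (P + 1))).coeff w := by
    intro P
    induction P with
    | zero => intro _; simp [blockStart]
    | succ P ih =>
      intro hP
      have hle := blockStart_le ha hP
      rw [ih (by omega), coeff_mul_tailA_block (c := blockStart a (P + 1) + 1) (by omega) y
        (a (P + 1) - blockStart a (P + 1)) _ le_rfl fun r h1 h2 =>
          not_isDescent_of_lt ha hw (i := P + 1) (by omega) hP (by omega) (by omega)]
      rw [List.range'_1_concat, List.map_append, List.prod_append, ← mul_assoc]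
      have h1 : blockStart a (P + 1) + (a (P + 1) - blockStart a (P + 1)) =
          blockStart a (P + 1 + 1) := by
        rw [Nat.add_sub_cancel' hle, blockStart, if_neg (by omega)]
        rfl
      rw [h1, add_comm 1 P]
      simp only [List.map_cons, List.map_nil, List.prod_cons, List.prod_nil, mul_one]
      rfl
  rw [key p le_rfl, coeff_mul_tailA]
  intro r hr h
  rw [blockStart, if_neg (by omega)] at hr
  obtain ⟨j, hj1, hj2, rfl⟩ := hw r h
  have := ha.monotoneOn (Set.mem_Icc.2 ⟨hj1, hj2⟩) (Set.mem_Icc.2 ⟨hp, le_rfl⟩) hj2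
  simp only [Nat.add_sub_cancel] at hr
  omega

/-- Inversion reverses the order of the operators in a block. Commutativity of the `A_c` restores
it. -/
theorem unop_invHom_blockA' (n : ℕ) (z : ℕ → Series) (b : ℕ → ℕ) (i : ℕ) :
    (invHom (blockA' n z b i)).unop = blockA n (-z) b i := by
  rw [blockA', unop_invHom_list_prod, ← List.map_reverse, List.map_map]
  simp only [Function.comp_def, unop_invHom_opA']
  refine List.Perm.prod_eq' ((List.reverse_perm _).map _) ?_
  rw [List.pairwise_map]
  exact List.pairwise_of_forall fun _ _ => opA_commute (by omega) _ _

theorem coeff_mul_eq_coeff_unop_invHom {R : Type} [CommRing R] (ξ η : NilCoxeter R) (w : WeylD) :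
    (ξ * η).coeff w = ((invHom η).unop * (invHom ξ).unop).coeff w⁻¹ := by
  rw [← MulOpposite.unop_mul, ← map_mul, coeff_invHom, inv_inv]

/-- Inversion turns left factors `Ã_i(z)` into right factors `A_i(-z)` and `w` into `w⁻¹`, which
reduces this to `coeff_mul_tailA_eq`. -/
theorem coeff_headA'_mul_eq {n q : ℕ} (hq : 1 ≤ q) {b : ℕ → ℕ}
    (hb : StrictMonoOn b (Set.Icc 1 q)) {w : WeylD} (hw : IsCompatible w⁻¹ q b) (z : ℕ → Series)
    (ξ : NilCoxeter Series) :
    (((List.range' 1 (n - 1)).reverse.map fun i => opA' n i (z i)).prod * ξ).coeff w =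
      (((List.range' 1 q).reverse.map (blockA' n z b)).prod * ξ).coeff w := by
  rw [coeff_mul_eq_coeff_unop_invHom, coeff_mul_eq_coeff_unop_invHom _ ξ, unop_invHom_list_prod,
    unop_invHom_list_prod, ← List.map_reverse, ← List.map_reverse, List.reverse_reverse,
    List.reverse_reverse, List.map_map, List.map_map]
  have h1 : (fun ξ => (invHom ξ).unop) ∘ blockA' n z b = blockA n (-z) b :=
    funext fun i => unop_invHom_blockA' n z b i
  have h2 := coeff_mul_tailA_eq (n := n) hq hb hw (-z) (invHom ξ).unop
  rw [h1, ← h2]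
  simp only [Function.comp_def, unop_invHom_opA']
  rfl

/-! ### Series without `x`-variables -/

/-- The series in which no `x`-variable occurs. -/
def xFree : Subring Series where
  carrier := {c | ∀ m : Var →₀ ℕ, MvPowerSeries.coeff m c ≠ 0 → m.support.sup xIndex = 0}
  zero_mem' m h := absurd (map_zero _) h
  one_mem' m h := by
    classical
    rw [MvPowerSeries.coeff_one] at h
    have : m = 0 := by
      by_contra h0
      exact h (if_neg h0)
    simp [this]
  add_mem' {c d} hc hd m h := by
    rw [map_add] at h
    by_contra h0
    exact h (by rw [not_imp_comm.1 (hc m) h0, not_imp_comm.1 (hd m) h0, add_zero])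
  neg_mem' {c} hc m h := hc m (by simpa using h)
  mul_mem' {c d} hc hd m h := by
    classical
    rw [MvPowerSeries.coeff_mul] at h
    obtain ⟨⟨k, l⟩, hkl, hne⟩ := Finset.exists_ne_zero_of_sum_ne_zero h
    rw [Finset.HasAntidiagonal.mem_antidiagonal] at hkl
    have h1 := hc k (left_ne_zero_of_mul hne)
    have h2 := hd l (right_ne_zero_of_mul hne)
    refine Nat.le_zero.1 ((Finset.sup_mono (hkl ▸ Finsupp.support_add)).trans ?_)
    rw [Finset.sup_union, h1, h2, sup_idem]

theorem X_mem_xFree {v : Var} (hv : xIndex v = 0) : (MvPowerSeries.X v : Series) ∈ xFree := by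
  classical
  intro m h
  rw [MvPowerSeries.coeff_X] at h
  have : m = Finsupp.single v 1 := by
    by_contra h0
    exact h (if_neg h0)
  rw [this]
  refine Nat.le_zero.1 ((Finset.sup_mono Finsupp.support_single_subset).trans ?_)
  rw [Finset.sup_singleton, hv]

theorem factor_mem_coeffSubring {S : Subring Series} {t : Series} (ht : t ∈ S) (i : ℕ) :
    factor i t ∈ coeffSubring S :=
  Subring.add_mem _ (Subring.one_mem _) (single_mem_coeffSubring ht)

theorem list_map_prod_mem {A : Type*} [Ring A] {S : Subring A} {f : ℕ → A} (hf : ∀ i, f i ∈ S)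
    (l : List ℕ) : (l.map f).prod ∈ S :=
  S.list_prod_mem fun x hx => by
    obtain ⟨i, -, rfl⟩ := List.mem_map.1 hx
    exact hf i

theorem stanleyG_mem_xFree (u : WeylD) (I J : List ℕ) : stanleyG u I J ∈ xFree := by
  refine Subring.mul_mem (coeffSubring xFree) (list_map_prod_mem (fun j => ?_) _)
    (list_map_prod_mem (fun i => ?_) _) u
  · exact list_map_prod_mem (factor_mem_coeffSubring (xFree.neg_mem (X_mem_xFree rfl))) _
  · exact list_map_prod_mem (factor_mem_coeffSubring (X_mem_xFree rfl)) _

/-- In a contributing decomposition `m = k + l`, the part `k` from `c` has no `x`-variable. Thus `m`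
and `l` have the same last `x`-variable and select the same truncation of `f`. -/
theorem xLimit_mul {c : Series} (hc : c ∈ xFree) (f : ℕ → Series) :
    xLimit (fun N => c * f N) = c * xLimit f := by
  classical
  ext m
  change MvPowerSeries.coeff m (c * f (m.support.sup xIndex)) = _
  rw [MvPowerSeries.coeff_mul, MvPowerSeries.coeff_mul]
  refine Finset.sum_congr rfl fun ⟨k, l⟩ hkl => ?_
  by_cases h0 : MvPowerSeries.coeff k c = 0
  · rw [h0, zero_mul, zero_mul]
  rw [Finset.HasAntidiagonal.mem_antidiagonal] at hkl
  have h1 : m.support.sup xIndex = l.support.sup xIndex := by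
    apply le_antisymm
    · refine (Finset.sup_mono (hkl ▸ Finsupp.support_add)).trans ?_
      rw [Finset.sup_union, hc k h0]
      simp
    · refine Finset.sup_mono fun v hv => ?_
      rw [Finsupp.mem_support_iff] at hv ⊢
      rw [← hkl]
      exact fun h => hv (Nat.add_eq_zero_iff.1 h).2
  rw [h1]
  rfl

theorem xLimit_sum {ι : Type*} (s : Finset ι) (f : ι → ℕ → Series) :
    xLimit (fun N => ∑ i ∈ s, f i N) = ∑ i ∈ s, xLimit (f i) := by
  ext m
  rw [map_sum]
  exact map_sum (MvPowerSeries.coeff m) (fun i => f i (m.support.sup xIndex)) s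

/-! ### Coefficients of the factors -/

/-- Independence of `n`: projecting to `W̃_m`, with `m` the rank of `u`, keeps the coefficient of
`u` and truncates every operator to level `m`. -/
theorem coeff_prod_opA_eq_stanleyG {n : ℕ} (hn : 2 ≤ n) {u : WeylD} (hu : u ∈ weylSubgroup n)
    (I : List ℕ) : (I.map fun i => opA n 1 (varY i)).prod.coeff u = stanleyG u I [] := by
  have h := coeff_proj (isParabolic_weylSubgroup (rank_spec u).1)
    (I.map fun i => opA n 1 (varY i)).prod u
  rw [if_pos (mem_weylSubgroup_rank u), map_list_prod, List.map_map] at h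
  simp only [Function.comp_def, proj_weylSubgroup_opA (rank_spec u).1 (rank_le hn hu)] at h
  rw [← h, stanleyG, List.map_nil, List.prod_nil, one_mul]

theorem coeff_prod_opA'_eq_stanleyG {n : ℕ} (hn : 2 ≤ n) {u : WeylD} (hu : u ∈ weylSubgroup n)
    (J : List ℕ) : (J.map fun j => opA' n 1 (varZ j)).prod.coeff u = stanleyG u [] J := by
  have h := coeff_proj (isParabolic_weylSubgroup (rank_spec u).1)
    (J.map fun i => opA' n 1 (varZ i)).prod u
  rw [if_pos (mem_weylSubgroup_rank u), map_list_prod, List.map_map] at h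
  simp only [Function.comp_def, proj_weylSubgroup_opA' (rank_spec u).1 (rank_le hn hu)] at h
  rw [← h, stanleyG, List.map_nil, List.prod_nil, mul_one]

-- The block is the image of a product of `A_1`'s under projection to `permSubgroup`. The vanishing
-- outside this subgroup is the source of the compatibility conditions.
open Classical in
theorem coeff_blockA {n : ℕ} (hn : 2 ≤ n) {u : WeylD} (hu : u ∈ weylSubgroup n) (a : ℕ → ℕ)
    (i : ℕ) : (blockA n varY a i).coeff u =
      if u ∈ permSubgroup (blockStart a i) then stanleyG u (block a i) [] else 0 := by
  rw [← coeff_prod_opA_eq_stanleyG hn hu, ← coeff_proj (isParabolic_permSubgroup _),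
    map_list_prod, List.map_map]
  simp only [Function.comp_def, proj_permSubgroup_opA]
  rfl

open Classical in
theorem coeff_blockA' {n : ℕ} (hn : 2 ≤ n) {u : WeylD} (hu : u ∈ weylSubgroup n) (b : ℕ → ℕ)
    (i : ℕ) : (blockA' n varZ b i).coeff u =
      if u ∈ permSubgroup (blockStart b i) then stanleyG u [] (block b i) else 0 := by
  rw [← coeff_prod_opA'_eq_stanleyG hn hu, ← coeff_proj (isParabolic_permSubgroup _),
    map_list_prod, List.map_map]
  simp only [Function.comp_def, proj_permSubgroup_opA']
  rfl

/-- The type D double mixed Stanley function in the variables `x_1, …, x_N`. -/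
def truncStanleyI (u : WeylD) (I J : List ℕ) (N : ℕ) : Series :=
  ((J.map fun j => opA' (rank u) 1 (varZ j)).prod * prodD (rank u) N *
    (I.map fun i => opA (rank u) 1 (varY i)).prod).coeff u

theorem coeff_middle {n : ℕ} (hn : 2 ≤ n) {u : WeylD} (hu : u ∈ weylSubgroup n) (a b : ℕ → ℕ)
    (N : ℕ) : (blockA' n varZ b 1 * prodD n N * blockA n varY a 1).coeff u =
      truncStanleyI u (block a 1) (block b 1) N := by
  have h := coeff_proj (isParabolic_weylSubgroup (rank_spec u).1)
    (blockA' n varZ b 1 * prodD n N * blockA n varY a 1) u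
  rw [if_pos (mem_weylSubgroup_rank u), map_mul, map_mul, blockA, blockA', map_list_prod,
    map_list_prod, List.map_map, List.map_map, proj_weylSubgroup_prodD (rank_spec u).1 (rank_le hn hu)] at h
  simp only [Function.comp_def, proj_weylSubgroup_opA (rank_spec u).1 (rank_le hn hu),
    proj_weylSubgroup_opA' (rank_spec u).1 (rank_le hn hu)] at h
  exact h.symm

/-! ### The splitting formula -/

/-- The factors of the product whose coefficients are the terms of the splitting formula; the
index `k` counts from `0`. -/
def splitFactor (n N q : ℕ) (a b : ℕ → ℕ) (k : ℕ) : NilCoxeter Series :=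
  if k + 1 < q then blockA' n varZ b (q - k)
  else if k + 1 = q then blockA' n varZ b 1 * prodD n N * blockA n varY a 1
  else blockA n varY a (k + 2 - q)

/-- The first alphabets of both sides are merged with `D(X)` into one factor, which accounts for the
number `p + q - 1`. -/
theorem prod_splitFactor {p q : ℕ} (hp : 1 ≤ p) (hq : 1 ≤ q) (n N : ℕ) (a b : ℕ → ℕ) :
    (List.ofFn fun k : Fin (p + q - 1) => splitFactor n N q a b k).prod =
      ((List.range' 1 q).reverse.map (blockA' n varZ b)).prod * prodD n N *
        ((List.range' 1 p).map (blockA n varY a)).prod := by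
  obtain ⟨p, rfl⟩ : ∃ k, p = k + 1 := ⟨p - 1, by omega⟩
  obtain ⟨q, rfl⟩ : ∃ k, q = k + 1 := ⟨q - 1, by omega⟩
  have h0 : List.ofFn (fun k : Fin (p + 1 + (q + 1) - 1) => splitFactor n N (q + 1) a b k) =
      (List.range (q + 1 + p)).map (splitFactor n N (q + 1) a b) := by
    rw [show p + 1 + (q + 1) - 1 = q + 1 + p by omega]
    refine List.ext_getElem (by simp) fun i h1 h2 => by simp
  have h1 : (List.range q).map (splitFactor n N (q + 1) a b) =
      (List.range' 2 q).reverse.map (blockA' n varZ b) := by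
    rw [List.reverse_range', List.map_map]
    refine List.map_congr_left fun k hk => ?_
    rw [List.mem_range] at hk
    rw [splitFactor, if_pos (by omega), Function.comp_apply]
    congr 1
    omega
  have h2 : (List.range p).map (splitFactor n N (q + 1) a b ∘ fun i => q + 1 + i) =
      (List.range' 2 p).map (blockA n varY a) := by
    rw [List.range'_eq_map_range, List.map_map]
    refine List.map_congr_left fun k _ => ?_
    rw [Function.comp_apply, splitFactor, if_neg (by omega), if_neg (by omega),
      Function.comp_apply]
    congr 1
    omega
  have h3 : splitFactor n N (q + 1) a b q =
      blockA' n varZ b 1 * prodD n N * blockA n varY a 1 := by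
    rw [splitFactor, if_neg (by omega), if_pos rfl]
  rw [h0, List.range_add, List.range_succ, List.map_append, List.map_append, List.map_map, h1, h2,
    List.range'_succ, List.range'_succ, List.reverse_cons, List.map_append]
  simp only [List.map_cons, List.map_nil, List.prod_append, List.prod_cons, List.prod_nil, mul_one,
    h3, mul_assoc]

/-- The splitting term with the `x`-variables truncated to `x_1, …, x_N`. -/
def truncTerm (p q : ℕ) (a b : ℕ → ℕ) (u : Fin (p + q - 1) → WeylD) (N : ℕ) : Series :=
  ∏ k : Fin (p + q - 1), let j : ℕ := k + 1
    if j < q then stanleyG (u k) [] (block b (q + 1 - j))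
    else if j = q then truncStanleyI (u k) (block a 1) (block b 1) N
    else stanleyG (u k) (block a (j - q + 1)) []

theorem xLimit_truncTerm {p q : ℕ} (hp : 1 ≤ p) (hq : 1 ≤ q) (a b : ℕ → ℕ)
    (u : Fin (p + q - 1) → WeylD) :
    xLimit (truncTerm p q a b u) = splittingTerm p q a b u := by
  let k₀ : Fin (p + q - 1) := ⟨q - 1, by omega⟩
  let g : Fin (p + q - 1) → Series := fun k =>
    if (k : ℕ) + 1 < q then stanleyG (u k) [] (block b (q + 1 - (k + 1)))
    else stanleyG (u k) (block a (k + 1 - q + 1)) []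
  have h0 : (k₀ : ℕ) + 1 = q := Nat.sub_add_cancel hq
  -- Isolates the only factor containing `x`-variables. It is used once with the truncated Stanley
  -- functions as `F` and once with their limits.
  have key : ∀ F : Fin (p + q - 1) → Series, (∏ k : Fin (p + q - 1),
      (if (k : ℕ) + 1 < q then stanleyG (u k) [] (block b (q + 1 - (k + 1)))
      else if (k : ℕ) + 1 = q then F k
      else stanleyG (u k) (block a (k + 1 - q + 1)) [])) =
      (∏ k ∈ Finset.univ.erase k₀, g k) * F k₀ := by
    intro F
    rw [← Finset.prod_erase_mul _ _ (Finset.mem_univ k₀)]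
    congr 1
    · refine Finset.prod_congr rfl fun k hk => ?_
      have hne : (k : ℕ) + 1 ≠ q := fun h =>
        (Finset.mem_erase.1 hk).1 (Fin.ext (by omega))
      simp only [g, if_neg hne]
    · rw [if_neg (by omega), if_pos h0]
  have hg : ∏ k ∈ Finset.univ.erase k₀, g k ∈ xFree := by
    refine Subring.prod_mem _ fun k _ => ?_
    simp only [g]
    split_ifs <;> exact stanleyG_mem_xFree _ _ _
  have h1 : truncTerm p q a b u = fun N => (∏ k ∈ Finset.univ.erase k₀, g k) *
      truncStanleyI (u k₀) (block a 1) (block b 1) N :=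
    funext fun N => key fun k : Fin (p + q - 1) => truncStanleyI (u k) (block a 1) (block b 1) N
  rw [h1, xLimit_mul hg]
  exact (key fun k : Fin (p + q - 1) => stanleyI (u k) (block a 1) (block b 1)).symm

theorem finite_compatibleFactorizations (w : WeylD) (p q : ℕ) (a b : ℕ → ℕ) :
    (compatibleFactorizations w p q a b).Finite := by
  refine (Set.Finite.pi' fun _ => finite_weylSubgroup (rank w)).subset fun u hu k => ?_
  exact hu.1.mem (isParabolic_weylSubgroup (rank_spec w).1) (mem_weylSubgroup_rank w) k

/-- The conditions on the factor `u_{k+1}` of a compatible factorization. -/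
def IsCompatibleFactor (q : ℕ) (a b : ℕ → ℕ) (k : ℕ) (v : WeylD) : Prop :=
  (k + 1 ≠ q → IsTypeA v) ∧
    (k + 1 < q → ∀ i : ℕ, 1 ≤ i → i ≤ b (q - (k + 1)) → v.1 i = i) ∧
    (q < k + 1 → ∀ i : ℕ, 1 ≤ i → i ≤ a (k + 1 - q) → v.1 i = i)

theorem mem_compatibleFactorizations {w : WeylD} {p q : ℕ} {a b : ℕ → ℕ}
    {u : Fin (p + q - 1) → WeylD} : u ∈ compatibleFactorizations w p q a b ↔
      IsReducedFactorization u w ∧ ∀ k : Fin (p + q - 1), IsCompatibleFactor q a b k (u k) := Iff.rfl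

open Classical in
theorem coeff_splitFactor {n : ℕ} (hn : 2 ≤ n) {u : WeylD} (hu : u ∈ weylSubgroup n) (N q : ℕ)
    (a b : ℕ → ℕ) (k : ℕ) : (splitFactor n N q a b k).coeff u =
      if IsCompatibleFactor q a b k u then
        if k + 1 < q then stanleyG u [] (block b (q + 1 - (k + 1)))
        else if k + 1 = q then truncStanleyI u (block a 1) (block b 1) N
        else stanleyG u (block a (k + 1 - q + 1)) []
      else 0 := by
  rcases lt_trichotomy (k + 1) q with h | h | h
  · have hs : blockStart b (q - k) = b (q - (k + 1)) := by
      rw [blockStart, if_neg (by omega), Nat.sub_add_eq]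
    have hc : IsCompatibleFactor q a b k u ↔ u ∈ permSubgroup (b (q - (k + 1))) :=
      ⟨fun hc => ⟨hc.1 h.ne, hc.2.1 h⟩, fun hm => ⟨fun _ => hm.1, fun _ => hm.2, fun h' => by omega⟩⟩
    rw [splitFactor, if_pos h, coeff_blockA' hn hu, hs]
    simp only [hc, if_pos h, Nat.add_sub_add_right]
  · have hc : IsCompatibleFactor q a b k u :=
      ⟨fun h' => absurd h h', fun h' => by omega, fun h' => by omega⟩
    rw [splitFactor, if_neg h.not_lt, if_pos h, coeff_middle hn hu, if_pos hc, if_neg h.not_lt,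
      if_pos h]
  · have hs : blockStart a (k + 2 - q) = a (k + 1 - q) := by
      rw [blockStart, if_neg (by omega)]
      congr 1
      omega
    have hc : IsCompatibleFactor q a b k u ↔ u ∈ permSubgroup (a (k + 1 - q)) :=
      ⟨fun hc => ⟨hc.1 h.ne', hc.2.2 h⟩, fun hm => ⟨fun _ => hm.1, fun h' => by omega, fun _ => hm.2⟩⟩
    rw [splitFactor, if_neg h.not_gt, if_neg h.ne', coeff_blockA hn hu, hs]
    simp only [hc, if_neg h.not_gt, if_neg h.ne', show k + 1 - q + 1 = k + 2 - q by omega]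

/-- A reduced factorization that is not compatible has a factor with coefficient `0`, so only
compatible ones survive. All factors lie in `W̃_n` with `n` the rank of `w`, as this group is
parabolic. -/
theorem coeff_prod_splitFactor (w : WeylD) (p q N : ℕ) (a b : ℕ → ℕ) :
    (List.ofFn fun k : Fin (p + q - 1) => splitFactor (rank w) N q a b k).prod.coeff w =
      ∑ᶠ u ∈ compatibleFactorizations w p q a b, truncTerm p q a b u N := by
  classical
  rw [coeff_prod_ofFn, finsum_mem_def, finsum_mem_def]
  refine finsum_congr fun u => ?_
  rw [Set.indicator_apply, Set.indicator_apply, mem_compatibleFactorizations]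
  by_cases hu : IsReducedFactorization u w
  · have hn := (rank_spec w).1
    have hmem := fun k : Fin (p + q - 1) => hu.mem (isParabolic_weylSubgroup hn) (mem_weylSubgroup_rank w) k
    rw [if_pos (show u ∈ {u | IsReducedFactorization u w} from hu)]
    simp only [fun k : Fin (p + q - 1) => coeff_splitFactor hn (hmem k) N q a b]
    by_cases hc : ∀ k : Fin (p + q - 1), IsCompatibleFactor q a b k (u k)
    · rw [if_pos ⟨hu, hc⟩]
      exact Finset.prod_congr rfl fun k _ => if_pos (hc k)
    · rw [if_neg fun h => hc h.2]
      obtain ⟨k, hk⟩ := not_forall.1 hc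
      exact Finset.prod_eq_zero (Finset.mem_univ k) (if_neg hk)
  · rw [if_neg (show u ∉ {u | IsReducedFactorization u w} from hu), if_neg fun h => hu h.1]

end TypeDSchubert

end

open TypeDSchubert in
theorem doubleSchubert_eq_finsum (p q : ℕ) (hp : 1 ≤ p) (hq : 1 ≤ q) (a b : ℕ → ℕ)
    (ha : StrictMonoOn a (Set.Icc 1 p)) (hb : StrictMonoOn b (Set.Icc 1 q)) (w : WeylD)
    (hwa : IsCompatible w p a) (hwb : IsCompatible w⁻¹ q b) :
    doubleSchubert w = ∑ᶠ u ∈ compatibleFactorizations w p q a b, splittingTerm p q a b u := by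
  have hf := finite_compatibleFactorizations w p q a b
  -- For fixed `N` the `z`-side and then the `y`-side are regrouped. The index set of the sum does
  -- not depend on `N`, so the limit can be taken termwise.
  have h1 : ∀ N, (((List.range' 1 (rank w - 1)).reverse.map fun i =>
      opA' (rank w) i (varZ i)).prod * prodD (rank w) N *
      ((List.range' 1 (rank w - 1)).map fun i => opA (rank w) i (varY i)).prod).coeff w =
      ∑ u ∈ hf.toFinset, truncTerm p q a b u N := by
    intro N
    rw [← finsum_mem_eq_finite_toFinset_sum _ hf, ← coeff_prod_splitFactor,
      prod_splitFactor hp hq, mul_assoc, coeff_headA'_mul_eq hq hb hwb varZ, ← mul_assoc]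
    exact coeff_mul_tailA_eq hp ha hwa varY _
  rw [doubleSchubert, finsum_mem_eq_finite_toFinset_sum _ hf]
  simp only [h1, xLimit_sum, ← xLimit_truncTerm hp hq]

theorem proposition4p11 (p q : ℕ) (hp : 1 ≤ p) (hq : 1 ≤ q) (a b : ℕ → ℕ)
    (ha : StrictMonoOn a (Set.Icc 1 p)) (hb : StrictMonoOn b (Set.Icc 1 q))
    (w : TypeDSchubert.WeylD)
    (hwa : TypeDSchubert.IsCompatible w p a) (hwb : TypeDSchubert.IsCompatible w⁻¹ q b) :
    (TypeDSchubert.compatibleFactorizations w p q a b).Finite ∧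
      TypeDSchubert.doubleSchubert w =
        ∑ᶠ u ∈ TypeDSchubert.compatibleFactorizations w p q a b,
          TypeDSchubert.splittingTerm p q a b u :=
  ⟨TypeDSchubert.finite_compatibleFactorizations w p q a b,
    doubleSchubert_eq_finsum p q hp hq a b ha hb w hwa hwb⟩
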